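/- Notation. An index is a finite sequence $\mathbf k=(k_1,\dots,k_r)$ of positive integers; $I(k,r)$ is the (finite) set of all indices with $r$ entries and $k_1+\cdots+k_r=k$; $\{1\}_r$ is the index consisting of $r$ ones. For $n\ge 1$ the multiple $T$-harmonic sum is $$T_n(k_1,\dots,k_r)=2^r\sum \prod_{\substack{1\le j\le r\\ j\ \mathrm{odd}}}\frac1{(2n_j-1)^{k_j}}\prod_{\substack{1\le j\le r\\ j\ \mathrm{even}}}\frac1{(2n_j)^{k_j}},$$ where the sum runs over all positive integers $n_1,\dots,n_r$ with $n_1\le n_2<n_3\le n_4<\cdots$ ($n_j\le n_{j+1}$ for odd $j$, $n_j<n_{j+1}$ for even $j$), and $n_r\le n$ if $r$ is odd, $n_r<n$ if $r$ is even (an empty sum is $0$). The alternating multiple $T$-values and their sums over all indices of given weight and depth are $$\overline T(k_1,\dots,k_r)=2^r\sum_{0<n_1<\cdots<n_r}\frac{(-1)^{n_r}}{(2n_1-1)^{k_1}(2n_2-2)^{k_2}\cdots(2n_r-r)^{k_r}},\qquad W(k,r)=\sum_{\mathbf k\in I(k,r)}\overline T(\mathbf k),$$ where the series is understood as the limit,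 as $N\to\infty$, of the finite sums over $n_r\le N$. Put $\overline\zeta(k)=\sum_{n\ge1}(-1)^{n-1}n^{-k}$ for $k\ge1$, and for integers $1\le j\le p$ put $Z(p,p)=1$ and, if $j<p$, $$Z(j,p)=\sum_{k=1}^{p-j}(-2)^k\sum_{j=i_0<i_1<\cdots<i_k=p}\ \prod_{l=1}^k\overline\zeta(2i_l-2i_{l-1}).$$ Theorem. Let $m,p$ be positive integers. Then all the series $\overline T(\mathbf k)$ occurring in $W(2j+2m-1,2m)$, $1\le j\le p$, converge, the series on the left below converges, and $$\sum_{n=1}^\infty \frac{T_n(\{1\}_{2m-1})\,T_n(\{1\}_{2p-1})}{n}(-1)^n=(-1)^m\sum_{j=1}^p W(2j+2m-1,2m)\,Z(j,p).$$ -/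

import Mathlib

open Filter Topology

noncomputable section

/-- The multiple `T`-harmonic sum `T_n(k_1, …, k_r)` (the entry `k_{i+1}` of the index
is `k i` for `i : Fin r`; so `Even i` says that the one-based position `i + 1` is odd).
It is the sum of `∏ 2 / (2 n_j - 1)^{k_j}` (odd positions `j`), `2 / (2 n_j)^{k_j}` (even positions `j`)
over all positive integers with `n_1 ≤ n_2 < n_3 ≤ n_4 < ⋯`, where the chain ends in
`n_r ≤ n` if `r` is odd and in `n_r < n` if `r` is even. The sum is `0` if there are no such tuples,
and the sum for the empty index is `1`. -/
def multipleTHarmonicSum (n : ℕ) {r : ℕ} (k : Fin r → ℕ) : ℝ :=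
  ∑ ν ∈ (Fintype.piFinset fun _ : Fin r => Finset.Icc 1 n) with
      (∀ i j : Fin r, i.val + 1 = j.val → if Even i.val then ν i ≤ ν j else ν i < ν j) ∧
      (∀ i : Fin r, i.val + 1 = r → if Even i.val then ν i ≤ n else ν i < n),
    ∏ i : Fin r, 2 / (if Even i.val then 2 * (ν i : ℝ) - 1 else 2 * (ν i : ℝ)) ^ k i

/-- The sum defining the alternating multiple `T`-value `T̄(k_1, …, k_r)`, truncated at `n_r ≤ N`:
the sum of `2^r (-1)^{n_r} / ((2 n_1 - 1)^{k_1} (2 n_2 - 2)^{k_2} ⋯ (2 n_r - r)^{k_r})` over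
`0 < n_1 < ⋯ < n_r ≤ N`. -/
def altMTVPartialSum {r : ℕ} (k : Fin r → ℕ) (N : ℕ) : ℝ :=
  2 ^ r * ∑ ν ∈ (Fintype.piFinset fun _ : Fin r => Finset.Icc 1 N) with StrictMono ν,
    ∏ i : Fin r, (if i.val + 1 = r then (-1 : ℝ) ^ ν i else 1) /
      (2 * (ν i : ℝ) - ((i.val : ℝ) + 1)) ^ k i

/-- The alternating multiple `T`-value `T̄(k_1, …, k_r)` (the sign is attached to the last summation
variable `n_r`). For `k_r = 1` the series converges only conditionally, and it is summed according
to the largest summation variable. -/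
def altMTV {r : ℕ} (k : Fin r → ℕ) : ℝ :=
  limUnder atTop (altMTVPartialSum k)

/-- The set `I(w, r)` of all indices (tuples of positive integers) of weight `w` and depth `r`. -/
def indexSet (w r : ℕ) : Finset (Fin r → ℕ) :=
  {k ∈ Fintype.piFinset fun _ : Fin r => Finset.Icc 1 w | ∑ i, k i = w}

/-- The sum `W(w, r)` of all `T̄(k_1, …, k_r)` of weight `w` and depth `r`. -/
def sumW (w r : ℕ) : ℝ :=
  ∑ k ∈ indexSet w r, altMTV k

/-- The partial sums of `∑_{n ≥ 1} (-1)^{n-1} / n^k`. -/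
def altZetaPartialSum (k N : ℕ) : ℝ :=
  ∑ n ∈ Finset.Icc 1 N, (-1 : ℝ) ^ (n - 1) / (n : ℝ) ^ k

/-- The alternating zeta value `ζ̄(k) = ∑_{n ≥ 1} (-1)^{n-1} / n^k` for `k ≥ 1`, and `ζ̄(0) = 1/2`. -/
def altZeta (k : ℕ) : ℝ :=
  if k = 0 then 1 / 2 else limUnder atTop (altZetaPartialSum k)

/-- The limit in the definition of `altZeta` exists. -/
theorem tendsto_altZetaPartialSum {k : ℕ} (hk : 1 ≤ k) :
    Tendsto (altZetaPartialSum k) atTop (𝓝 (altZeta k)) := by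
  have hk0 : k ≠ 0 := by omega
  have hanti : Antitone fun n : ℕ => 1 / ((n : ℝ) + 1) ^ k := by
    intro a b hab
    have hab' : (a : ℝ) ≤ b := by exact_mod_cast hab
    dsimp only
    gcongr
  have hzero : Tendsto (fun n : ℕ => 1 / ((n : ℝ) + 1) ^ k) atTop (𝓝 0) := by
    have h := (tendsto_one_div_add_atTop_nhds_zero_nat (𝕜 := ℝ)).pow k
    simpa [hk0] using h
  obtain ⟨l, hl⟩ := hanti.tendsto_alternating_series_of_tendsto_zero hzero
  have heq : altZetaPartialSum k =
      fun N => ∑ n ∈ Finset.range N, (-1 : ℝ) ^ n * (1 / ((n : ℝ) + 1) ^ k) := by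
    funext N
    unfold altZetaPartialSum
    induction N with
    | zero => simp
    | succ N ih =>
      rw [Finset.sum_Icc_succ_top (by omega), ih, Finset.sum_range_succ]
      push_cast
      simp [div_eq_mul_inv]
  rw [← heq] at hl
  unfold altZeta
  rw [if_neg hk0]
  exact tendsto_nhds_limUnder ⟨l, hl⟩

/-- `Z(j, p) = ∑_{k=1}^{p-j} (-2)^k ∑_{j = i_0 < i_1 < ⋯ < i_k = p} ∏_{l=1}^k ζ̄(2 i_l - 2 i_{l-1})`
for `j < p`, and `Z(p, p) = 1`. -/
def coeffZ (j p : ℕ) : ℝ :=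
  if j = p then 1 else
    ∑ k ∈ Finset.Icc 1 (p - j), (-2 : ℝ) ^ k *
      ∑ i ∈ (Fintype.piFinset fun _ : Fin (k + 1) => Finset.Icc j p) with
          StrictMono i ∧ i 0 = j ∧ i (Fin.last k) = p,
        ∏ l : Fin k, altZeta (2 * i l.succ - 2 * i l.castSucc)

end

/-! Put M_s(n) = n ∫_0^1 x^{n-1} (log((1+x)/(1-x)))^s / s! dx (`cayleyMoment`). Integration by parts
gives M_{s+1}(n+2) = M_{s+1}(n) + 2/(n+1) M_s(n+1), which is also the recursion of the sums
T_n({1}_r), split by the parity of r. Comparing initial values, M_{2p+1}(2n) is the sum over 0 ≤ q ≤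
p of M_{2q}(1) T_n({1}_{2(p-q)+1}), where M_0(1) = 1 and M_{2q}(1) = 2 ζ̄(2q) for q > 0
(`cayleyMoment_eq_sum`). The numbers Z are the entries of the inverse of this unitriangular system,
so T_n({1}_{2p-1}) is a combination of M_{2j-1}(2n) with coefficients Z(j,p)
(`onesTSum_eq_sum_cayleyMoment`).

It remains to evaluate the alternating sum of T_n({1}_r) M_s(2n)/n with r = 2m-1 and s odd. After a
shift of n, the T_n({1}_r) are partial sums of coefficients of (2 arctan x)^r / r!, hence generate
that function divided by 1+x^2. Integrating against the logarithm and substituting x = (1-t)/(1+t),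
which turns arctan x into π/4 - arctan t, leads to the integral of 2/(1+t^2) · (2(π/4 - arctan t))^r
/ r! · (-log t)^s / s! over the unit interval.

On the other side, W(r+s,r) is, up to sign, the value at x = 1 of a power series F_{r,s}
(`depthSeries`), and these satisfy F_{r+1,s}' = F_{r+1,s-1}/x + 2/(1+x^2) F_{r,s}. A telescoping
bilinear combination of the F_{i,j} with powers of the logarithm and of π/4 - arctan x is an
antiderivative of the integrand above, so the same integral is ±W(r+1+s,r+1)
(`integral_coarctanPow_mul_logPow`).

The series need not converge absolutely. Their terms are bounded by powers of log n over n, with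
increments smaller by another factor n, so summation by parts gives convergence. Interchanges of sum
and integral are made inside the unit disc, and Abel's limit theorem carries the result to the
boundary. -/

theorem sum_Icc_one_add_eq_sum_range {a : ℕ → ℝ} {m : ℕ} (hm : 1 ≤ m)
    (h : ∀ n, 1 ≤ n → n < m → a n = 0) (i : ℕ) :
    ∑ n ∈ Finset.Icc 1 (m + i), a n = ∑ j ∈ Finset.range (i + 1), a (m + j) := by
  induction i with
  | zero =>
    rw [Finset.sum_eq_single_of_mem m (by simp; omega)]
    · simp
    · intro b hb hbm
      simp at hb
      exact h b hb.1 (by omega)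
  | succ i ih =>
    rw [← add_assoc, Finset.sum_Icc_succ_top (by omega), ih, Finset.sum_range_succ _ (i + 1)]
    rfl

/-! ### Strictly increasing tuples -/

/-- The strictly increasing `r`-tuples with entries in `{1, …, N}`. -/
def strictTuples (r N : ℕ) : Finset (Fin r → ℕ) :=
  {ν ∈ Fintype.piFinset fun _ : Fin r => Finset.Icc 1 N | StrictMono ν}

theorem strictMono_snoc_iff {r : ℕ} (ν : Fin r → ℕ) (n : ℕ) :
    StrictMono (Fin.snoc (α := fun _ => ℕ) ν n) ↔ StrictMono ν ∧ ∀ i, ν i < n := by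
  constructor
  · intro h
    refine ⟨fun i j hij => ?_, fun i => ?_⟩
    · simpa using h (Fin.castSucc_lt_castSucc_iff.2 hij)
    · simpa using h (Fin.castSucc_lt_last i)
  · rintro ⟨h, hn⟩ i j hij
    induction j using Fin.lastCases with
    | last =>
      induction i using Fin.lastCases with
      | last => exact absurd hij (lt_irrefl _)
      | cast i => simpa using hn i
    | cast j =>
      induction i using Fin.lastCases with
      | last => exact absurd hij (not_lt.2 (Fin.le_last _))
      | cast i => simpa using h (Fin.castSucc_lt_castSucc_iff.1 hij)

theorem sum_strictTuples_succ {r N : ℕ} (g : (Fin (r + 1) → ℕ) → ℝ) :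
    ∑ ν ∈ strictTuples (r + 1) N, g ν =
      ∑ n ∈ Finset.Icc 1 N, ∑ ν ∈ strictTuples r (n - 1),
        g (Fin.snoc (α := fun _ => ℕ) ν n) := by
  rw [Finset.sum_sigma']
  symm
  refine Finset.sum_bij' (fun x _ => Fin.snoc (α := fun _ => ℕ) x.2 x.1)
    (fun ν _ => ⟨ν (Fin.last r), Fin.init ν⟩) ?_ ?_ ?_ ?_ ?_
  · rintro ⟨n, ν⟩ h
    simp only [Finset.mem_sigma, strictTuples, Finset.mem_filter, Fintype.mem_piFinset,
      Finset.mem_Icc] at h ⊢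
    refine ⟨fun i => ?_, (strictMono_snoc_iff ν n).2 ⟨h.2.2, fun i => ?_⟩⟩
    · induction i using Fin.lastCases with
      | last => simpa using h.1
      | cast i => have := h.2.1 i; simp; omega
    · have := h.2.1 i; omega
  · intro ν h
    simp only [Finset.mem_sigma, strictTuples, Finset.mem_filter, Fintype.mem_piFinset,
      Finset.mem_Icc] at h ⊢
    have h2 := h.2
    rw [← Fin.snoc_init_self ν, strictMono_snoc_iff] at h2
    refine ⟨h.1 _, fun i => ?_, h2.1⟩
    have h3 := h2.2 i
    have h4 : 1 ≤ Fin.init ν i := (h.1 i.castSucc).1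
    omega
  · rintro ⟨n, ν⟩ h
    simp
  · intro ν h
    simp
  · rintro ⟨n, ν⟩ h
    rfl

theorem strictTuples_eq_empty {r N : ℕ} (h : N < r) : strictTuples r N = ∅ := by
  rw [Finset.eq_empty_iff_forall_notMem]
  intro ν hν
  simp only [strictTuples, Finset.mem_filter, Fintype.mem_piFinset] at hν
  have := Finset.card_le_card_of_injOn (s := (Finset.univ : Finset (Fin r)))
    (t := Finset.Icc 1 N) ν (fun i _ => hν.1 i) hν.2.injective.injOn
  simp at this
  omega

/-- The nested sums `∑_{i ≥ i_r ≥ ⋯ ≥ i_1} ∏ (j + 2 i_j)^{-k_j}`. -/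
noncomputable def nestedSum : {r : ℕ} → (Fin r → ℕ) → ℕ → ℝ
  | 0, _, _ => 1
  | r + 1, k, i => ∑ j ∈ Finset.range (i + 1),
      nestedSum (Fin.init k) j / ((r : ℝ) + 1 + 2 * j) ^ k (Fin.last r)

/-- The substitution n_l = l + i_l turns strict chains into weakly increasing ones, starting from
i_l ≥ 0, and the denominators 2 n_l - l into l + 2 i_l. -/
theorem sum_strictTuples_prod {r : ℕ} (k : Fin r → ℕ) (i : ℕ) :
    ∑ ν ∈ strictTuples r (r + i), ∏ l : Fin r, 1 / (2 * (ν l : ℝ) - ((l.val : ℝ) + 1)) ^ k l =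
      nestedSum k i := by
  induction r generalizing i with
  | zero =>
    simp [nestedSum, strictTuples, Finset.filter_true_of_mem, Subsingleton.strictMono]
  | succ r ih =>
    rw [sum_strictTuples_succ, sum_Icc_one_add_eq_sum_range (m := r + 1) (by omega)]
    · rw [nestedSum]
      refine Finset.sum_congr rfl fun j _ => ?_
      rw [show r + 1 + j - 1 = r + j by omega, ← ih, Finset.sum_div]
      refine Finset.sum_congr rfl fun ν _ => ?_
      rw [Fin.prod_univ_castSucc]
      simp only [Fin.snoc_castSucc, Fin.snoc_last, Fin.val_castSucc, Fin.val_last, Fin.init]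
      rw [mul_one_div]
      congr 2
      push_cast
      ring
    · intro n hn1 hn
      rw [strictTuples_eq_empty (by omega)]
      simp

theorem altMTVPartialSum_succ_add {r : ℕ} (k : Fin (r + 1) → ℕ) (i : ℕ) :
    altMTVPartialSum k (r + 1 + i) = 2 ^ (r + 1) * ∑ j ∈ Finset.range (i + 1),
      (-1 : ℝ) ^ (r + 1 + j) *
        (nestedSum (Fin.init k) j / ((r : ℝ) + 1 + 2 * j) ^ k (Fin.last r)) := by
  unfold altMTVPartialSum
  congr 1
  change ∑ ν ∈ strictTuples (r + 1) (r + 1 + i), _ = _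
  rw [sum_strictTuples_succ, sum_Icc_one_add_eq_sum_range (m := r + 1) (by omega)]
  · refine Finset.sum_congr rfl fun j _ => ?_
    rw [show r + 1 + j - 1 = r + j by omega, ← sum_strictTuples_prod, Finset.sum_div,
      Finset.mul_sum]
    refine Finset.sum_congr rfl fun ν _ => ?_
    rw [Fin.prod_univ_castSucc]
    simp only [Fin.snoc_castSucc, Fin.snoc_last, Fin.val_castSucc, Fin.val_last, Fin.init,
      if_true]
    have h1 : ∏ l : Fin r, (if l.val + 1 = r + 1 then (-1 : ℝ) ^ ν l else 1) /
        (2 * (ν l : ℝ) - ((l.val : ℝ) + 1)) ^ k l.castSucc =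
        ∏ l : Fin r, 1 / (2 * (ν l : ℝ) - ((l.val : ℝ) + 1)) ^ k l.castSucc := by
      refine Finset.prod_congr rfl fun l _ => ?_
      rw [if_neg (by have := l.2; omega)]
    have h2 : 2 * ((r + 1 + j : ℕ) : ℝ) - ((r : ℝ) + 1) = r + 1 + 2 * j := by
      push_cast
      ring
    rw [h1, h2]
    ring
  · intro n hn1 hn
    rw [strictTuples_eq_empty (by omega)]
    simp

/-! ### Indices -/

theorem sum_indexSet_succ {r s : ℕ} (g : (Fin (r + 1) → ℕ) → ℝ) :
    ∑ k ∈ indexSet (r + 1 + s) (r + 1), g k =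
      ∑ a ∈ Finset.range (s + 1), ∑ k ∈ indexSet (r + (s - a)) r,
        g (Fin.snoc (α := fun _ => ℕ) k (a + 1)) := by
  rw [Finset.sum_sigma']
  symm
  have key : ∀ {r w : ℕ} {k : Fin r → ℕ}, k ∈ indexSet w r ↔ (∀ i, 1 ≤ k i) ∧ ∑ i, k i = w := by
    intro r w k
    simp only [indexSet, Finset.mem_filter, Fintype.mem_piFinset, Finset.mem_Icc]
    refine ⟨fun h => ⟨fun i => (h.1 i).1, h.2⟩, fun h => ⟨fun i => ⟨h.1 i, ?_⟩, h.2⟩⟩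
    rw [← h.2]
    exact Finset.single_le_sum (fun _ _ => Nat.zero_le _) (Finset.mem_univ i)
  refine Finset.sum_bij' (fun x _ => Fin.snoc (α := fun _ => ℕ) x.2 (x.1 + 1))
    (fun k _ => ⟨k (Fin.last r) - 1, Fin.init k⟩) ?_ ?_ ?_ ?_ ?_
  · rintro ⟨a, k⟩ h
    simp only [Finset.mem_sigma, key, Finset.mem_range] at h ⊢
    refine ⟨fun i => ?_, ?_⟩
    · induction i using Fin.lastCases with
      | last => simp
      | cast i => simpa using h.2.1 i
    · rw [Fin.sum_univ_castSucc]
      simp only [Fin.snoc_castSucc, Fin.snoc_last, h.2.2]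
      omega
  · intro k h
    simp only [Finset.mem_sigma, key, Finset.mem_range] at h ⊢
    have h1 := h.1 (Fin.last r)
    have h2 := h.2
    rw [Fin.sum_univ_castSucc] at h2
    have h3 : r ≤ ∑ i : Fin r, k i.castSucc := by
      calc r = ∑ _i : Fin r, 1 := by simp
        _ ≤ _ := Finset.sum_le_sum fun i _ => h.1 _
    refine ⟨by omega, fun i => h.1 _, ?_⟩
    change ∑ i : Fin r, k i.castSucc = _
    omega
  · rintro ⟨a, k⟩ h
    simp
  · intro k h
    rw [key] at h
    have h1 := h.1 (Fin.last r)
    simp only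
    rw [Nat.sub_add_cancel h1]
    simp
  · rintro ⟨n, ν⟩ h
    rfl

/-- The coefficients `e_{r,s}(i)` of the power series `∑_i (-1)^i e_{r,s}(i) x^{r+2i}`
attached to the sum of all indices of depth `r` and weight `r + s`. -/
noncomputable def depthCoeff : ℕ → ℕ → ℕ → ℝ
  | 0, 0, i => if i = 0 then 1 else 0
  | 0, _ + 1, _ => 0
  | r + 1, 0, i => 2 * (∑ j ∈ Finset.range (i + 1), depthCoeff r 0 j) / ((r : ℝ) + 1 + 2 * i)
  | r + 1, s + 1, i => (depthCoeff (r + 1) s i +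
      2 * ∑ j ∈ Finset.range (i + 1), depthCoeff r (s + 1) j) / ((r : ℝ) + 1 + 2 * i)

/-- The partial sums of `depthCoeff r s`. -/
noncomputable def depthSum (r s i : ℕ) : ℝ := ∑ j ∈ Finset.range (i + 1), depthCoeff r s j

/-- Unrolling the recursion in s: each step divides once more by r + 1 + 2i, and a + 1 becomes the
last entry of an index. -/
theorem depthCoeff_succ_eq_sum (r s i : ℕ) :
    depthCoeff (r + 1) s i =
      2 * ∑ a ∈ Finset.range (s + 1), depthSum r (s - a) i / ((r : ℝ) + 1 + 2 * i) ^ (a + 1) := by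
  induction s with
  | zero => simp [depthCoeff, depthSum, mul_div_assoc]
  | succ s ih =>
    rw [depthCoeff, ih, Finset.sum_range_succ' _ (s + 1), add_div, mul_div_assoc, mul_add,
      mul_div_assoc]
    congr 1
    · rw [Finset.sum_div]
      congr 1
      refine Finset.sum_congr rfl fun a _ => ?_
      rw [Nat.add_sub_add_right, div_div, ← pow_succ]
    · simp [depthSum]

/-- Induction on the depth, grouping the indices by their last entry; this ties the recursive
coefficients to the actual sums over indices. -/
theorem two_pow_mul_sum_nestedSum (r s i : ℕ) :
    2 ^ r * ∑ k ∈ indexSet (r + s) r, nestedSum k i = depthSum r s i := by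
  induction r generalizing s i with
  | zero =>
    rcases s with _ | s
    · have : indexSet 0 0 = {Fin.elim0} := by
        ext k
        simp [indexSet, Subsingleton.elim k Fin.elim0, eq_iff_true_of_subsingleton]
      simp [nestedSum, this, depthSum, depthCoeff]
    · simp [indexSet, depthSum, depthCoeff]
  | succ r ih =>
    rw [sum_indexSet_succ]
    rw [depthSum]
    simp only [nestedSum, Fin.init_snoc, Fin.snoc_last, depthCoeff_succ_eq_sum]
    have h : ∀ j : ℕ, ∑ a ∈ Finset.range (s + 1),
        depthSum r (s - a) j / ((r : ℝ) + 1 + 2 * j) ^ (a + 1) =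
        2 ^ r * ∑ a ∈ Finset.range (s + 1), ∑ k ∈ indexSet (r + (s - a)) r,
          nestedSum k j / ((r : ℝ) + 1 + 2 * j) ^ (a + 1) := by
      intro j
      rw [Finset.mul_sum]
      refine Finset.sum_congr rfl fun a _ => ?_
      rw [← ih, ← Finset.sum_div, mul_div_assoc]
    simp only [h, ← Finset.mul_sum]
    rw [pow_succ', mul_assoc]
    congr 2
    rw [Finset.sum_comm]
    refine Finset.sum_congr rfl fun a _ => ?_
    rw [Finset.sum_comm]

theorem sum_altMTVPartialSum (r s i : ℕ) :
    ∑ k ∈ indexSet (r + 1 + s) (r + 1), altMTVPartialSum k (r + 1 + i) =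
      (-1) ^ (r + 1) * ∑ j ∈ Finset.range (i + 1), (-1 : ℝ) ^ j * depthCoeff (r + 1) s j := by
  simp only [altMTVPartialSum_succ_add]
  rw [← Finset.mul_sum, Finset.sum_comm, Finset.mul_sum, Finset.mul_sum]
  refine Finset.sum_congr rfl fun j _ => ?_
  rw [← Finset.mul_sum, sum_indexSet_succ]
  simp only [Fin.init_snoc, Fin.snoc_last]
  rw [depthCoeff_succ_eq_sum]
  have h : ∀ a, ∑ k ∈ indexSet (r + (s - a)) r, nestedSum k j / ((r : ℝ) + 1 + 2 * j) ^ (a + 1) =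
      (1 / 2 ^ r) * (depthSum r (s - a) j / ((r : ℝ) + 1 + 2 * j) ^ (a + 1)) := by
    intro a
    rw [← two_pow_mul_sum_nestedSum, ← Finset.sum_div]
    field_simp
  simp only [h, ← Finset.mul_sum]
  rw [pow_succ' (2 : ℝ), pow_add (-1 : ℝ) (r + 1) j]
  field_simp

/-! ### Multiple `T`-harmonic sums of ones -/

/-- The tuples over which `multipleTHarmonicSum n` is summed. -/
def chainTuples (r n : ℕ) : Finset (Fin r → ℕ) :=
  {ν ∈ Fintype.piFinset fun _ : Fin r => Finset.Icc 1 n |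
    (∀ i j : Fin r, i.val + 1 = j.val → if Even i.val then ν i ≤ ν j else ν i < ν j) ∧
      (∀ i : Fin r, i.val + 1 = r → if Even i.val then ν i ≤ n else ν i < n)}

theorem chain_monotone {r : ℕ} {ν : Fin r → ℕ}
    (h : ∀ i j : Fin r, i.val + 1 = j.val → if Even i.val then ν i ≤ ν j else ν i < ν j) :
    Monotone ν := by
  rcases r with _ | r
  · intro i
    exact i.elim0
  · rw [Fin.monotone_iff_le_succ]
    intro i
    have := h i.castSucc i.succ (by simp)
    split_ifs at this <;> omega

theorem sum_chainTuples_succ {r N : ℕ} (g : (Fin (r + 1) → ℕ) → ℝ) :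
    ∑ ν ∈ chainTuples (r + 1) N, g ν =
      ∑ n ∈ Finset.Icc 1 N with (if Even r then n ≤ N else n < N), ∑ ν ∈ chainTuples r n,
        g (Fin.snoc (α := fun _ => ℕ) ν n) := by
  rw [Finset.sum_sigma']
  symm
  refine Finset.sum_bij' (fun x _ => Fin.snoc (α := fun _ => ℕ) x.2 x.1)
    (fun ν _ => ⟨ν (Fin.last r), Fin.init ν⟩) ?_ ?_ ?_ ?_ ?_
  · rintro ⟨n, ν⟩ h
    simp only [Finset.mem_sigma, chainTuples, Finset.mem_filter, Fintype.mem_piFinset,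
      Finset.mem_Icc] at h ⊢
    obtain ⟨⟨hn, hnN⟩, hν, hc, hl⟩ := h
    refine ⟨fun i => ?_, fun i j hij => ?_, fun i hi => ?_⟩
    · induction i using Fin.lastCases with
      | last => simpa using hn
      | cast i => have := hν i; simp; omega
    · induction i using Fin.lastCases with
      | last => have := j.2; simp at hij; omega
      | cast i =>
        induction j using Fin.lastCases with
        | last => simpa using hl i (by simpa using hij)
        | cast j => simpa using hc i j (by simpa using hij)
    · obtain rfl : i = Fin.last r := by ext; simp; omega
      simpa using hnN
  · intro ν h
    simp only [Finset.mem_sigma, chainTuples, Finset.mem_filter, Fintype.mem_piFinset,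
      Finset.mem_Icc] at h ⊢
    obtain ⟨hν, hc, hl⟩ := h
    refine ⟨⟨hν _, by simpa using hl (Fin.last r) (by simp)⟩, fun i => ⟨(hν _).1, ?_⟩,
      fun i j hij => hc i.castSucc j.castSucc (by simpa using hij),
      fun i hi => hc i.castSucc (Fin.last r) (by simpa using hi)⟩
    exact chain_monotone hc (Fin.le_last _)
  · rintro ⟨n, ν⟩ h
    simp
  · intro ν h
    simp
  · rintro ⟨n, ν⟩ h
    rfl

/-- `T_n({1}_r)`. -/
noncomputable def onesTSum (r n : ℕ) : ℝ := multipleTHarmonicSum n (fun _ : Fin r => 1)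

theorem onesTSum_zero (n : ℕ) : onesTSum 0 n = 1 := by
  simp [onesTSum, multipleTHarmonicSum]

theorem onesTSum_succ (r N : ℕ) :
    onesTSum (r + 1) N = ∑ n ∈ Finset.Icc 1 N with (if Even r then n ≤ N else n < N),
      2 / (if Even r then 2 * (n : ℝ) - 1 else 2 * n) * onesTSum r n := by
  unfold onesTSum multipleTHarmonicSum
  change ∑ ν ∈ chainTuples (r + 1) N, _ = _
  rw [sum_chainTuples_succ]
  refine Finset.sum_congr rfl fun n _ => ?_
  rw [Finset.mul_sum]
  refine Finset.sum_congr rfl fun ν _ => ?_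
  rw [Fin.prod_univ_castSucc, mul_comm]
  simp only [Fin.snoc_castSucc, Fin.snoc_last, Fin.val_castSucc, Fin.val_last, pow_one]

theorem onesTSum_succ_of_even {r : ℕ} (hr : Even r) (N : ℕ) :
    onesTSum (r + 1) N = ∑ n ∈ Finset.Icc 1 N, 2 / (2 * (n : ℝ) - 1) * onesTSum r n := by
  rw [onesTSum_succ]
  simp only [hr, if_true]
  rw [Finset.filter_true_of_mem]
  intro n hn
  exact (Finset.mem_Icc.1 hn).2

theorem onesTSum_succ_of_odd {r : ℕ} (hr : ¬ Even r) (N : ℕ) :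
    onesTSum (r + 1) (N + 1) = ∑ n ∈ Finset.Icc 1 N, 2 / (2 * (n : ℝ)) * onesTSum r n := by
  rw [onesTSum_succ]
  simp only [hr, if_false]
  refine Finset.sum_congr ?_ fun _ _ => rfl
  ext n
  simp
  omega

theorem onesTSum_succ_zero (r : ℕ) : onesTSum (r + 1) 0 = 0 := by
  rw [onesTSum_succ]
  simp

/-- Each new variable of the chain n_1 ≤ n_2 < n_3 ≤ ⋯ is compared weakly or strictly according to
parity, so the smallest n with a nonempty sum moves up by one at every second step. Counting from
that n, both parities obey the single recursion of `depthCoeff` with s = 0. The two parities are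
proved in alternation. -/
theorem onesTSum_eq_depthSum (m : ℕ) :
    ((∀ n, n ≤ m → onesTSum (2 * m + 1) n = 0) ∧
      ∀ i, onesTSum (2 * m + 1) (m + 1 + i) = depthSum (2 * m + 1) 0 i) ∧
    (∀ n, n ≤ m + 1 → onesTSum (2 * m + 2) n = 0) ∧
      ∀ i, onesTSum (2 * m + 2) (m + 2 + i) = depthSum (2 * m + 2) 0 i := by
  have step1 : ∀ m, (∀ n, 1 ≤ n → n ≤ m → onesTSum (2 * m) n = 0) →
      (∀ i, onesTSum (2 * m) (m + 1 + i) = depthSum (2 * m) 0 i) →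
      (∀ n, n ≤ m → onesTSum (2 * m + 1) n = 0) ∧
      ∀ i, onesTSum (2 * m + 1) (m + 1 + i) = depthSum (2 * m + 1) 0 i := by
    intro m h0 h
    refine ⟨fun n hn => ?_, fun i => ?_⟩
    · rw [onesTSum_succ_of_even (by simp)]
      refine Finset.sum_eq_zero fun j hj => ?_
      rw [Finset.mem_Icc] at hj
      rw [h0 j hj.1 (by omega), mul_zero]
    · rw [onesTSum_succ_of_even (by simp)]
      rw [← Finset.sum_filter_of_ne (p := fun n => m + 1 ≤ n)]
      · rw [Finset.sum_filter, sum_Icc_one_add_eq_sum_range (m := m + 1) (by omega)]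
        · rw [depthSum]
          refine Finset.sum_congr rfl fun j _ => ?_
          rw [if_pos (by omega), h, depthCoeff, depthSum]
          push_cast
          rw [show 2 * ((m : ℝ) + 1 + j) - 1 = 2 * m + 1 + 2 * j by ring]
          ring
        · intro n _ hn
          rw [if_neg (by omega)]
      · intro n hn hne
        by_contra hlt
        rw [h0 n (Finset.mem_Icc.1 hn).1 (by omega)] at hne
        simp at hne
  have step2 : ∀ m, (∀ n, n ≤ m → onesTSum (2 * m + 1) n = 0) →
      (∀ i, onesTSum (2 * m + 1) (m + 1 + i) = depthSum (2 * m + 1) 0 i) →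
      (∀ n, n ≤ m + 1 → onesTSum (2 * m + 2) n = 0) ∧
      ∀ i, onesTSum (2 * m + 2) (m + 2 + i) = depthSum (2 * m + 2) 0 i := by
    intro m h0 h
    have hodd : ¬ Even (2 * m + 1) := by simp
    refine ⟨fun n hn => ?_, fun i => ?_⟩
    · rcases n with _ | n
      · exact onesTSum_succ_zero _
      · rw [onesTSum_succ_of_odd hodd]
        refine Finset.sum_eq_zero fun j hj => ?_
        rw [Finset.mem_Icc] at hj
        rw [h0 j (by omega), mul_zero]
    · rw [show m + 2 + i = m + 1 + i + 1 by omega, onesTSum_succ_of_odd hodd,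
        sum_Icc_one_add_eq_sum_range (m := m + 1) (by omega)]
      · rw [depthSum]
        refine Finset.sum_congr rfl fun j _ => ?_
        rw [h, depthCoeff, depthSum]
        push_cast
        rw [show 2 * ((m : ℝ) + 1 + j) = 2 * m + 1 + 1 + 2 * j by ring]
        ring
      · intro n _ hn
        rw [h0 n (by omega), mul_zero]
  induction m with
  | zero =>
    have h1 := step1 0 (by intro n h1 h2; omega) (by
      intro i
      rw [mul_zero, onesTSum_zero, depthSum, Finset.sum_range_succ']
      simp [depthCoeff])
    exact ⟨h1, step2 0 h1.1 h1.2⟩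
  | succ m ih =>
    have h1 := step1 (m + 1) (fun n _ h => ih.2.1 n h) ih.2.2
    exact ⟨h1, step2 (m + 1) h1.1 h1.2⟩

/-! ### The recursion for the coefficients `Z` -/

/-- The sum over all chains `j = i_0 < ⋯ < i_k = p` in `coeffZ`. -/
noncomputable def chainZeta (k j p : ℕ) : ℝ :=
  ∑ i ∈ (Fintype.piFinset fun _ : Fin (k + 1) => Finset.Icc j p) with
      StrictMono i ∧ i 0 = j ∧ i (Fin.last k) = p,
    ∏ l : Fin k, altZeta (2 * i l.succ - 2 * i l.castSucc)

theorem chainZeta_eq_zero {k j p : ℕ} (h : p < j + k) : chainZeta k j p = 0 := by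
  unfold chainZeta
  refine Finset.sum_eq_zero fun i hi => ?_
  exfalso
  simp only [Finset.mem_filter] at hi
  obtain ⟨-, hm, h0, hl⟩ := hi
  have : ∀ l : Fin (k + 1), j + l.val ≤ i l := by
    intro l
    induction l using Fin.induction with
    | zero => simp [h0]
    | succ l ih =>
      have := hm (Fin.castSucc_lt_succ (i := l))
      simp at ih ⊢
      omega
  have := this (Fin.last k)
  simp at this
  omega

theorem chainZeta_zero (j p : ℕ) : chainZeta 0 j p = if j = p then 1 else 0 := by
  unfold chainZeta
  split_ifs with h
  · subst h
    simp only [Finset.univ_eq_empty, Finset.prod_empty, Finset.sum_const, nsmul_eq_mul, mul_one]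
    norm_cast
    rw [Finset.card_eq_one]
    have : Subsingleton (Fin (0 + 1)) := inferInstanceAs (Subsingleton (Fin 1))
    refine ⟨fun _ => j, ?_⟩
    ext i
    simp only [Finset.mem_filter, Fintype.mem_piFinset, Finset.mem_Icc, Finset.mem_singleton]
    constructor
    · rintro ⟨-, -, h, -⟩
      ext l
      rw [Subsingleton.elim l 0, h]
    · rintro rfl
      simp [Subsingleton.strictMono]
  · refine Finset.sum_eq_zero fun i hi => ?_
    simp only [Finset.mem_filter] at hi
    exact absurd (hi.2.2.1.symm.trans hi.2.2.2) h

theorem chainZeta_succ (k j p : ℕ) :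
    chainZeta (k + 1) j p =
      ∑ q ∈ Finset.Ioc j p, altZeta (2 * q - 2 * j) * chainZeta k q p := by
  unfold chainZeta
  simp only [Finset.mul_sum]
  rw [Finset.sum_sigma']
  symm
  refine Finset.sum_bij' (fun x _ => Fin.cons (α := fun _ => ℕ) j x.2)
    (fun i _ => ⟨i 1, Fin.tail i⟩) ?_ ?_ ?_ ?_ ?_
  · rintro ⟨q, i⟩ h
    simp only [Finset.mem_sigma, Finset.mem_filter, Fintype.mem_piFinset,
      Finset.mem_Icc, Finset.mem_Ioc] at h ⊢
    obtain ⟨hq, hi, hm, h0, hl⟩ := h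
    refine ⟨fun l => ?_, ?_, ?_, ?_⟩
    · induction l using Fin.cases with
      | zero => simp; omega
      | succ l => have := hi l; simp; omega
    · intro a b hab
      induction b using Fin.cases with
      | zero => exact absurd hab (by simp)
      | succ b =>
        induction a using Fin.cases with
        | zero => have := hi b; simp; omega
        | succ a => simpa using hm (Fin.succ_lt_succ_iff.1 hab)
    · simp
    · rw [← Fin.succ_last]
      simpa using hl
  · intro i h
    simp only [Finset.mem_sigma, Finset.mem_filter, Fintype.mem_piFinset,
      Finset.mem_Icc, Finset.mem_Ioc] at h ⊢
    obtain ⟨hi, hm, h0, hl⟩ := h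
    refine ⟨⟨?_, (hi 1).2⟩, fun l => ⟨?_, (hi _).2⟩, fun a b hab => hm (Fin.succ_lt_succ_iff.2 hab),
      rfl, ?_⟩
    · rw [← h0]
      exact hm (by simp)
    · exact hm.monotone (by rw [← Fin.succ_zero_eq_one]; exact Fin.succ_le_succ_iff.2 (Fin.zero_le _))
    · rw [← hl, ← Fin.succ_last]
      rfl
  · rintro ⟨q, i⟩ h
    simp only [Finset.mem_sigma, Finset.mem_filter] at h
    obtain ⟨hq, hi, hm, h0, hl⟩ := h
    have : (Fin.cons j i : Fin (k + 2) → ℕ) 1 = i 0 := rfl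
    simp [this, h0]
  · intro i h
    simp only [Finset.mem_filter] at h
    rw [← h.2.2.1]
    simp
  · rintro ⟨q, i⟩ h
    simp only [Finset.mem_sigma, Finset.mem_filter] at h
    rw [Fin.prod_univ_succ, ← h.2.2.2.1]
    rfl

/-- Admitting chains of length 0 merges the two cases in the definition of Z, and chains that are
too long contribute 0, so the range of k may be enlarged freely. -/
theorem coeffZ_eq_sum {j p M : ℕ} (hj : j ≤ p) (hM : p - j < M) :
    coeffZ j p = ∑ k ∈ Finset.range M, (-2 : ℝ) ^ k * chainZeta k j p := by
  have h1 : ∑ k ∈ Finset.range M, (-2 : ℝ) ^ k * chainZeta k j p =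
      ∑ k ∈ Finset.range (p - j + 1), (-2 : ℝ) ^ k * chainZeta k j p := by
    symm
    refine Finset.sum_subset (by simpa using hM) fun k _ hk => ?_
    rw [chainZeta_eq_zero (by simp at hk; omega), mul_zero]
  rw [h1, Finset.sum_range_succ', chainZeta_zero]
  unfold coeffZ
  split_ifs with h
  · subst h
    simp
  · rw [mul_zero, add_zero]
    change ∑ k ∈ _, (-2 : ℝ) ^ k * chainZeta k j p = _
    rw [Finset.range_eq_Ico, Finset.sum_Ico_add' (fun k => (-2 : ℝ) ^ k * chainZeta k j p)]
    rfl

theorem coeffZ_self (p : ℕ) : coeffZ p p = 1 := if_pos rfl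

/-- Split a chain at its first step i_1 = q. In this form Z is visibly the inverse of the
unitriangular matrix with entries 2 ζ̄(2q - 2j) above the diagonal. -/
theorem coeffZ_of_lt {j p : ℕ} (hj : j < p) :
    coeffZ j p = -2 * ∑ q ∈ Finset.Ioc j p, altZeta (2 * q - 2 * j) * coeffZ q p := by
  rw [coeffZ_eq_sum hj.le (M := p - j + 1) (by omega), Finset.sum_range_succ', chainZeta_zero,
    if_neg hj.ne, mul_zero, add_zero]
  simp only [chainZeta_succ, Finset.mul_sum]
  rw [Finset.sum_comm]
  refine Finset.sum_congr rfl fun q hq => ?_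
  rw [Finset.mem_Ioc] at hq
  rw [coeffZ_eq_sum hq.2 (M := p - j) (by omega), Finset.mul_sum, Finset.mul_sum]
  refine Finset.sum_congr rfl fun k _ => ?_
  ring

/-! ### Sequences of logarithmic growth -/

/-- `f n` is bounded by a power of `log n`, and its increments by such a power divided by `n`. -/
def LogGrowth (f : ℕ → ℝ) : Prop :=
  ∃ (C : ℝ) (k : ℕ), ∀ n : ℕ, |f n| ≤ C * (1 + Real.log (n + 1)) ^ k ∧
    |f (n + 1) - f n| ≤ C * (1 + Real.log (n + 1)) ^ k / (n + 1)

/-- `g n` is bounded by a power of `log n` divided by `n`, and its increments by such a power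
divided by `n ^ 2`. -/
def LogDecay (g : ℕ → ℝ) : Prop :=
  ∃ (C : ℝ) (k : ℕ), ∀ n : ℕ, |g n| ≤ C * (1 + Real.log (n + 1)) ^ k / (n + 1) ∧
    |g (n + 1) - g n| ≤ C * (1 + Real.log (n + 1)) ^ k / (n + 1) ^ 2

theorem one_le_one_add_log (n : ℕ) : 1 ≤ 1 + Real.log ((n : ℝ) + 1) := by
  have : 0 ≤ Real.log ((n : ℝ) + 1) := Real.log_nonneg (by linarith [n.cast_nonneg (α := ℝ)])
  linarith

theorem one_add_log_mono {m n : ℕ} (h : m ≤ n) :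
    1 + Real.log ((m : ℝ) + 1) ≤ 1 + Real.log ((n : ℝ) + 1) := by
  gcongr

theorem one_add_log_succ_le (n : ℕ) :
    1 + Real.log (((n + 1 : ℕ) : ℝ) + 1) ≤ 2 * (1 + Real.log ((n : ℝ) + 1)) := by
  have h0 : (0 : ℝ) ≤ n := n.cast_nonneg
  have h1 : Real.log (((n + 1 : ℕ) : ℝ) + 1) ≤ Real.log (2 * ((n : ℝ) + 1)) := by
    apply Real.log_le_log
    · positivity
    · push_cast
      linarith
  rw [Real.log_mul (by norm_num) (by positivity)] at h1
  have h2 : Real.log 2 ≤ 1 := by linarith [Real.log_two_lt_d9]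
  have h3 := one_le_one_add_log n
  linarith

theorem one_add_log_pow_le (k : ℕ) :
    ∃ C : ℝ, 0 ≤ C ∧ ∀ n : ℕ, (1 + Real.log ((n : ℝ) + 1)) ^ k ≤ C * ((n : ℝ) + 1) ^ (1 / 2 : ℝ) := by
  -- Chosen so that ε k ≤ 1/2, after bounding the logarithm by a multiple of the power ε.
  set ε : ℝ := 1 / (2 * (k + 1)) with hε
  have hε0 : 0 < ε := by positivity
  refine ⟨(1 + 1 / ε) ^ k, by positivity, fun n => ?_⟩
  have hn : (1 : ℝ) ≤ (n : ℝ) + 1 := by linarith [n.cast_nonneg (α := ℝ)]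
  have h1 : 1 + Real.log ((n : ℝ) + 1) ≤ (1 + 1 / ε) * ((n : ℝ) + 1) ^ ε := by
    have := Real.log_le_rpow_div (by linarith : (0 : ℝ) ≤ (n : ℝ) + 1) hε0
    have h2 := Real.one_le_rpow hn hε0.le
    rw [div_eq_mul_one_div] at this
    nlinarith
  calc (1 + Real.log ((n : ℝ) + 1)) ^ k ≤ ((1 + 1 / ε) * ((n : ℝ) + 1) ^ ε) ^ k := by
        have := one_le_one_add_log n
        gcongr
    _ = (1 + 1 / ε) ^ k * ((n : ℝ) + 1) ^ (ε * k) := by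
        rw [mul_pow, Real.rpow_mul (by linarith), Real.rpow_natCast]
    _ ≤ _ := by
        gcongr
        · rw [hε, div_mul_eq_mul_div, div_le_div_iff₀ (by positivity) (by positivity)]
          linarith

theorem LogGrowth.exists_bound {f : ℕ → ℝ} (hf : LogGrowth f) :
    ∃ C : ℝ, ∀ n : ℕ, |f n| ≤ C * ((n : ℝ) + 1) := by
  obtain ⟨C, k, h⟩ := hf
  obtain ⟨D, hD, h'⟩ := one_add_log_pow_le k
  refine ⟨|C| * D, fun n => (h n).1.trans ?_⟩
  have hn : (1 : ℝ) ≤ (n : ℝ) + 1 := by linarith [n.cast_nonneg (α := ℝ)]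
  have h1 : ((n : ℝ) + 1) ^ (1 / 2 : ℝ) ≤ (n : ℝ) + 1 := by
    conv_rhs => rw [← Real.rpow_one ((n : ℝ) + 1)]
    exact Real.rpow_le_rpow_of_exponent_le hn (by norm_num)
  have := one_le_one_add_log n
  calc C * (1 + Real.log ((n : ℝ) + 1)) ^ k ≤ |C| * (D * ((n : ℝ) + 1) ^ (1 / 2 : ℝ)) := by
        gcongr
        · exact le_abs_self C
        · exact h' n
    _ ≤ |C| * (D * ((n : ℝ) + 1)) := by gcongr
    _ = _ := by ring

theorem LogGrowth.const (c : ℝ) : LogGrowth fun _ => c :=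
  ⟨|c|, 0, fun n => by simp; positivity⟩

theorem LogDecay.logGrowth {g : ℕ → ℝ} (hg : LogDecay g) : LogGrowth g := by
  obtain ⟨C, k, h⟩ := hg
  refine ⟨C, k, fun n => ?_⟩
  have hn : (1 : ℝ) ≤ (n : ℝ) + 1 := by linarith [n.cast_nonneg (α := ℝ)]
  have h0 : 0 ≤ C * (1 + Real.log ((n : ℝ) + 1)) ^ k := by
    have := (abs_nonneg _).trans (h n).1
    rwa [le_div_iff₀ (by positivity), zero_mul] at this
  refine ⟨(h n).1.trans (div_le_self h0 hn), (h n).2.trans ?_⟩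
  gcongr
  nlinarith

/-- A common bound for two sequences of logarithmic growth. -/
theorem exists_common_bound (C D : ℝ) (k l : ℕ) : ∃ E : ℝ, ∃ m : ℕ, 0 ≤ E ∧
    (∀ n : ℕ, C * (1 + Real.log ((n : ℝ) + 1)) ^ k ≤ E * (1 + Real.log ((n : ℝ) + 1)) ^ m) ∧
    ∀ n : ℕ, D * (1 + Real.log ((n : ℝ) + 1)) ^ l ≤ E * (1 + Real.log ((n : ℝ) + 1)) ^ m := by
  refine ⟨max |C| |D|, max k l, by positivity, fun n => ?_, fun n => ?_⟩
  · have := one_le_one_add_log n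
    gcongr
    · exact (le_abs_self C).trans (le_max_left _ _)
    · exact le_max_left _ _
  · have := one_le_one_add_log n
    gcongr
    · exact (le_abs_self D).trans (le_max_right _ _)
    · exact le_max_right _ _

theorem LogGrowth.add {f g : ℕ → ℝ} (hf : LogGrowth f) (hg : LogGrowth g) :
    LogGrowth fun n => f n + g n := by
  obtain ⟨C, k, h⟩ := hf
  obtain ⟨D, l, h'⟩ := hg
  obtain ⟨E, m, hE, h1, h2⟩ := exists_common_bound C D k l
  refine ⟨2 * E, m, fun n => ⟨(abs_add_le _ _).trans ?_, ?_⟩⟩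
  · linarith [(h n).1, (h' n).1, h1 n, h2 n]
  · rw [add_sub_add_comm]
    refine (abs_add_le _ _).trans ?_
    have a1 := (h n).2.trans (div_le_div_of_nonneg_right (h1 n) (by positivity))
    have a2 := (h' n).2.trans (div_le_div_of_nonneg_right (h2 n) (by positivity))
    calc _ ≤ _ := add_le_add a1 a2
      _ = _ := by ring

theorem LogGrowth.sum {ι : Type*} (s : Finset ι) {f : ι → ℕ → ℝ}
    (hf : ∀ i ∈ s, LogGrowth (f i)) : LogGrowth fun n => ∑ i ∈ s, f i n := by
  classical
  induction s using Finset.induction_on with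
  | empty => simpa using LogGrowth.const 0
  | insert a s ha ih =>
    simp only [Finset.sum_insert ha]
    exact (hf a (by simp)).add (ih fun i hi => hf i (by simp [hi]))

theorem LogGrowth.mul {f g : ℕ → ℝ} (hf : LogGrowth f) (hg : LogGrowth g) :
    LogGrowth fun n => f n * g n := by
  obtain ⟨C, k, h⟩ := hf
  obtain ⟨D, l, h'⟩ := hg
  obtain ⟨E, m, hE, h1, h2⟩ := exists_common_bound C D k l
  refine ⟨3 * E ^ 2, m + m, fun n => ?_⟩
  set L := (1 + Real.log ((n : ℝ) + 1)) ^ m with hL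
  have hL1 : 1 ≤ L := one_le_pow₀ (one_le_one_add_log n)
  have hn : (1 : ℝ) ≤ (n : ℝ) + 1 := by linarith [n.cast_nonneg (α := ℝ)]
  have hf0 : |f n| ≤ E * L := (h n).1.trans (h1 n)
  have hg0 : |g n| ≤ E * L := (h' n).1.trans (h2 n)
  have hf1 := (h n).2.trans (div_le_div_of_nonneg_right (h1 n) (by positivity))
  have hg1 := (h' n).2.trans (div_le_div_of_nonneg_right (h2 n) (by positivity))
  have hEL : 0 ≤ E * L := by positivity
  have hf2 : |f (n + 1)| ≤ 2 * (E * L) := by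
    have h3 : E * L / ((n : ℝ) + 1) ≤ E * L := div_le_self hEL hn
    have h4 := abs_add_le (f (n + 1) - f n) (f n)
    rw [sub_add_cancel] at h4
    linarith
  rw [pow_add, ← hL]
  constructor
  · rw [abs_mul]
    have := mul_le_mul hf0 hg0 (abs_nonneg _) hEL
    nlinarith [mul_nonneg hEL hEL]
  · rw [show f (n + 1) * g (n + 1) - f n * g n =
      f (n + 1) * (g (n + 1) - g n) + (f (n + 1) - f n) * g n by ring]
    refine (abs_add_le _ _).trans ?_
    rw [abs_mul, abs_mul]
    have a1 := mul_le_mul hf2 hg1 (abs_nonneg _) (by positivity)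
    have a2 := mul_le_mul hf1 hg0 (abs_nonneg _) (by positivity)
    calc _ ≤ _ := add_le_add a1 a2
      _ = _ := by ring

theorem LogGrowth.mul_logDecay {f g : ℕ → ℝ} (hf : LogGrowth f) (hg : LogDecay g) :
    LogDecay fun n => f n * g n := by
  obtain ⟨C, k, h⟩ := hf
  obtain ⟨D, l, h'⟩ := hg
  obtain ⟨E, m, hE, h1, h2⟩ := exists_common_bound C D k l
  refine ⟨3 * E ^ 2, m + m, fun n => ?_⟩
  set L := (1 + Real.log ((n : ℝ) + 1)) ^ m with hL
  have hL1 : 1 ≤ L := one_le_pow₀ (one_le_one_add_log n)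
  have hn : (1 : ℝ) ≤ (n : ℝ) + 1 := by linarith [n.cast_nonneg (α := ℝ)]
  have hf0 : |f n| ≤ E * L := (h n).1.trans (h1 n)
  have hg0 := (h' n).1.trans (div_le_div_of_nonneg_right (h2 n) (by positivity))
  have hf1 := (h n).2.trans (div_le_div_of_nonneg_right (h1 n) (by positivity))
  have hg1 := (h' n).2.trans (div_le_div_of_nonneg_right (h2 n) (by positivity))
  have hEL : 0 ≤ E * L := by positivity
  have hf2 : |f (n + 1)| ≤ 2 * (E * L) := by
    have h3 : E * L / ((n : ℝ) + 1) ≤ E * L := div_le_self hEL hn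
    have h4 := abs_add_le (f (n + 1) - f n) (f n)
    rw [sub_add_cancel] at h4
    linarith
  rw [pow_add, ← hL]
  constructor
  · rw [abs_mul]
    calc _ ≤ _ := mul_le_mul hf0 hg0 (abs_nonneg _) hEL
      _ = 1 * E ^ 2 * (L * L) / (n + 1) := by ring
      _ ≤ _ := by gcongr; norm_num
  · rw [show f (n + 1) * g (n + 1) - f n * g n =
      f (n + 1) * (g (n + 1) - g n) + (f (n + 1) - f n) * g n by ring]
    refine (abs_add_le _ _).trans ?_
    rw [abs_mul, abs_mul]
    have a1 := mul_le_mul hf2 hg1 (abs_nonneg _) (by positivity)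
    have a2 := mul_le_mul hf1 hg0 (abs_nonneg _) (by positivity)
    calc _ ≤ _ := add_le_add a1 a2
      _ = _ := by field_simp; ring

theorem LogGrowth.shift {f : ℕ → ℝ} (hf : LogGrowth f) : LogGrowth fun n => f (n + 1) := by
  obtain ⟨C, k, h⟩ := hf
  refine ⟨|C| * 2 ^ k, k, fun n => ?_⟩
  have h1 : C * (1 + Real.log (((n + 1 : ℕ) : ℝ) + 1)) ^ k ≤
      |C| * 2 ^ k * (1 + Real.log ((n : ℝ) + 1)) ^ k := by
    rw [mul_assoc, ← mul_pow]
    have := one_le_one_add_log (n + 1)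
    gcongr
    · exact le_abs_self C
    · exact one_add_log_succ_le n
  refine ⟨(h (n + 1)).1.trans h1, (h (n + 1)).2.trans ?_⟩
  refine (div_le_div_of_nonneg_right h1 (by positivity)).trans ?_
  have := one_le_one_add_log n
  gcongr
  linarith

theorem LogGrowth.shift_add {f : ℕ → ℝ} (hf : LogGrowth f) (m : ℕ) :
    LogGrowth fun n => f (m + n) := by
  induction m with
  | zero => simpa using hf
  | succ m ih =>
    have := ih.shift
    convert this using 3
    omega

/-- Summation against 1/(j+1) costs one more factor of the logarithm, by the bound on harmonic
numbers; the increments of the sum are the terms themselves. -/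
theorem LogGrowth.sum_range {g : ℕ → ℝ} {C : ℝ} {k : ℕ}
    (hg : ∀ n : ℕ, |g n| ≤ C * (1 + Real.log ((n : ℝ) + 1)) ^ k / (n + 1)) :
    LogGrowth fun n => ∑ j ∈ Finset.range n, g j := by
  have hC : 0 ≤ C := by simpa using (abs_nonneg _).trans (hg 0)
  refine ⟨C, k + 1, fun n => ?_⟩
  have h1 := one_le_one_add_log n
  have hH : ∑ j ∈ Finset.range n, 1 / ((j : ℝ) + 1) ≤ 1 + Real.log ((n : ℝ) + 1) := by
    have h2 := harmonic_le_one_add_log n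
    have h3 : ((harmonic n : ℚ) : ℝ) = ∑ j ∈ Finset.range n, 1 / ((j : ℝ) + 1) := by
      simp [harmonic]
    rw [h3] at h2
    refine h2.trans ?_
    rcases n with _ | n
    · simp
    · gcongr
      linarith
  constructor
  · calc |∑ j ∈ Finset.range n, g j| ≤ ∑ j ∈ Finset.range n, |g j| :=
          Finset.abs_sum_le_sum_abs _ _
      _ ≤ ∑ j ∈ Finset.range n, C * (1 + Real.log ((n : ℝ) + 1)) ^ k * (1 / ((j : ℝ) + 1)) := by
          refine Finset.sum_le_sum fun j hj => (hg j).trans ?_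
          rw [mul_one_div]
          have := one_le_one_add_log j
          have := one_add_log_mono (Finset.mem_range.1 hj).le
          gcongr
      _ ≤ _ := by
          rw [← Finset.mul_sum, pow_succ, ← mul_assoc]
          gcongr
  · simp only [Finset.sum_range_succ, add_sub_cancel_left]
    refine (hg n).trans ?_
    gcongr
    omega

theorem LogDecay.logGrowth_sum_range {g : ℕ → ℝ} (hg : LogDecay g) :
    LogGrowth fun n => ∑ j ∈ Finset.range n, g j := by
  obtain ⟨C, k, h⟩ := hg
  exact LogGrowth.sum_range fun n => (h n).1

theorem logDecay_one_div {c : ℝ} (hc : 1 ≤ c) : LogDecay fun n : ℕ => 1 / (c + 2 * (n : ℝ)) := by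
  refine ⟨2, 0, fun n => ?_⟩
  have hn : (0 : ℝ) ≤ n := n.cast_nonneg
  have h1 : 0 < c + 2 * (n : ℝ) := by linarith
  constructor
  · rw [abs_of_pos (by positivity), pow_zero, div_le_div_iff₀ h1 (by positivity)]
    linarith
  · have h2 : 0 < c + 2 * ((n + 1 : ℕ) : ℝ) := by push_cast; linarith
    rw [show 1 / (c + 2 * ((n + 1 : ℕ) : ℝ)) - 1 / (c + 2 * (n : ℝ)) =
      -(2 / ((c + 2 * (n : ℝ)) * (c + 2 * ((n + 1 : ℕ) : ℝ)))) by
        rw [div_sub_div _ _ h2.ne' h1.ne', ← neg_div, mul_comm (c + 2 * (n : ℝ))]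
        push_cast
        ring, abs_neg, abs_of_pos (by positivity), pow_zero, mul_one]
    gcongr
    push_cast
    nlinarith

theorem LogGrowth.div_pow {f : ℕ → ℝ} (hf : LogGrowth f) {c : ℝ} (hc : 1 ≤ c) {a : ℕ}
    (ha : 1 ≤ a) : LogDecay fun n => f n / (c + 2 * (n : ℝ)) ^ a := by
  induction a, ha using Nat.le_induction generalizing f with
  | base => simpa [div_eq_mul_one_div (f _)] using hf.mul_logDecay (logDecay_one_div hc)
  | succ a ha ih =>
    have := ih (hf.mul (logDecay_one_div hc).logGrowth)
    convert this using 2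
    rw [pow_succ', mul_one_div, div_div]

/-- Twice the partial sum equals boundary terms plus the alternating sum of g j - g (j + 1). These
differences are O(n^{-3/2}), since a power of the logarithm is O(n^{1/2}), so that sum converges
absolutely. -/
theorem LogDecay.exists_tendsto_alternating {g : ℕ → ℝ} (hg : LogDecay g) :
    ∃ l, Tendsto (fun n => ∑ j ∈ Finset.range n, (-1 : ℝ) ^ j * g j) atTop (𝓝 l) := by
  obtain ⟨C, k, h⟩ := hg
  obtain ⟨D, hD, h'⟩ := one_add_log_pow_le k
  have hbase : ∀ s : ℝ, (0:ℝ) < s → ∀ n : ℕ, C * (1 + Real.log ((n : ℝ) + 1)) ^ k / ((n : ℝ) + 1) ^ s ≤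
      |C| * D * (1 / ((n : ℝ) + 1) ^ (s - 1 / 2)) := by
    intro s hs n
    have hn : (0 : ℝ) < (n : ℝ) + 1 := by positivity
    have := one_le_one_add_log n
    rw [Real.rpow_sub hn, mul_one_div, div_div_eq_mul_div]
    rw [mul_assoc]
    gcongr
    · exact le_abs_self C
    · exact h' n
  have hzero : Tendsto g atTop (𝓝 0) := by
    have h1 : Tendsto (fun n : ℕ => |C| * D * (1 / ((n : ℝ) + 1) ^ (1 / 2 : ℝ))) atTop (𝓝 0) := by
      rw [show (0 : ℝ) = |C| * D * 0 by simp]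
      refine Tendsto.const_mul _ ?_
      simp only [one_div]
      refine Tendsto.inv_tendsto_atTop ((tendsto_rpow_atTop (by norm_num)).comp ?_)
      exact tendsto_atTop_add_const_right _ _ tendsto_natCast_atTop_atTop
    refine squeeze_zero_norm (fun n => ?_) h1
    rw [Real.norm_eq_abs]
    refine (h n).1.trans ?_
    have := hbase 1 one_pos n
    rw [Real.rpow_one] at this
    rwa [show (1 : ℝ) - 1 / 2 = 1 / 2 by norm_num] at this
  have hsum : Summable fun n : ℕ => (-1 : ℝ) ^ n * (g n - g (n + 1)) := by
    have h1 : Summable fun n : ℕ => |C| * D * (1 / ((n : ℝ) + 1) ^ (3 / 2 : ℝ)) := by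
      refine Summable.mul_left _ ?_
      have := (summable_nat_add_iff 1).2
        (Real.summable_one_div_nat_rpow.2 (by norm_num : (1 : ℝ) < 3 / 2))
      simpa using this
    refine Summable.of_norm_bounded h1 fun n => ?_
    rw [norm_mul, norm_pow, norm_neg, norm_one, one_pow, one_mul, Real.norm_eq_abs, abs_sub_comm]
    refine (h n).2.trans ?_
    have := hbase 2 two_pos n
    rwa [Real.rpow_two, show (2 : ℝ) - 1 / 2 = 3 / 2 by norm_num] at this
  have key : ∀ n, ∑ j ∈ Finset.range n, (-1 : ℝ) ^ j * g j =
      (g 0 - (-1) ^ n * g n + ∑ j ∈ Finset.range n, (-1 : ℝ) ^ j * (g j - g (j + 1))) / 2 := by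
    intro n
    induction n with
    | zero => simp
    | succ n ih =>
      rw [Finset.sum_range_succ, Finset.sum_range_succ, ih]
      ring
  simp only [key]
  refine ⟨(g 0 - 0 + ∑' n : ℕ, (-1 : ℝ) ^ n * (g n - g (n + 1))) / 2, ?_⟩
  refine Tendsto.div_const (Tendsto.add (Tendsto.sub tendsto_const_nhds ?_)
    hsum.hasSum.tendsto_sum_nat) 2
  refine squeeze_zero_norm (fun n => ?_) (tendsto_norm_zero.comp hzero)
  simp

/-! ### Logarithmic growth of the multiple sums and convergence of the series -/

theorem logGrowth_nestedSum {r : ℕ} {k : Fin r → ℕ} (hk : ∀ i, 1 ≤ k i) :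
    LogGrowth (nestedSum k) := by
  induction r with
  | zero => exact LogGrowth.const 1
  | succ r ih =>
    have h1 := (ih (k := Fin.init k) fun i => hk _).div_pow
      (c := (r : ℝ) + 1) (by linarith [r.cast_nonneg (α := ℝ)]) (hk (Fin.last r))
    exact h1.logGrowth_sum_range.shift

theorem one_le_of_mem_indexSet {w r : ℕ} {k : Fin r → ℕ} (hk : k ∈ indexSet w r) (i : Fin r) :
    1 ≤ k i := by
  simp only [indexSet, Finset.mem_filter, Fintype.mem_piFinset, Finset.mem_Icc] at hk
  exact (hk.1 i).1

theorem tendsto_altMTVPartialSum {r : ℕ} {k : Fin (r + 1) → ℕ} (hk : ∀ i, 1 ≤ k i) :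
    Tendsto (altMTVPartialSum k) atTop (𝓝 (altMTV k)) := by
  unfold altMTV
  refine tendsto_nhds_limUnder ?_
  obtain ⟨l, hl⟩ := ((logGrowth_nestedSum (k := Fin.init k) fun i => hk _).div_pow
      (c := (r : ℝ) + 1) (by linarith [r.cast_nonneg (α := ℝ)])
      (hk (Fin.last r))).exists_tendsto_alternating
  refine ⟨2 ^ (r + 1) * ((-1) ^ (r + 1) * l), ?_⟩
  rw [← tendsto_add_atTop_iff_nat (r + 1)]
  have := (((tendsto_add_atTop_iff_nat 1).2 hl).const_mul ((-1) ^ (r + 1))).const_mul (2 ^ (r + 1))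
  refine this.congr fun i => ?_
  rw [add_comm i (r + 1), altMTVPartialSum_succ_add, Finset.mul_sum]
  simp only [pow_add, mul_assoc]

theorem logGrowth_depthSum (r s : ℕ) : LogGrowth (depthSum r s) := by
  have : depthSum r s = fun i => 2 ^ r * ∑ k ∈ indexSet (r + s) r, nestedSum k i := by
    funext i
    rw [two_pow_mul_sum_nestedSum]
  rw [this]
  exact (LogGrowth.const _).mul
    (LogGrowth.sum _ fun k hk => logGrowth_nestedSum (one_le_of_mem_indexSet hk))

theorem exists_bound_depthCoeff (r s : ℕ) :
    ∃ C : ℝ, ∀ i : ℕ, |depthCoeff r s i| ≤ C * ((i : ℝ) + 1) := by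
  obtain ⟨C, hC⟩ := (logGrowth_depthSum r s).exists_bound
  have hC0 : 0 ≤ C := by simpa using (abs_nonneg _).trans (hC 0)
  refine ⟨2 * C, fun i => ?_⟩
  rcases i with _ | i
  · have := hC 0
    simp [depthSum] at this ⊢
    linarith
  · have h1 : depthCoeff r s (i + 1) = depthSum r s (i + 1) - depthSum r s i := by
      rw [depthSum, depthSum, Finset.sum_range_succ _ (i + 1)]
      ring
    rw [h1]
    refine (abs_sub _ _).trans ?_
    have h2 := hC (i + 1)
    have h3 := hC i
    push_cast at h2 ⊢
    nlinarith

/-- The sum `W` is the sum of an alternating series. -/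
theorem tendsto_alternating_depthCoeff (r s : ℕ) :
    Tendsto (fun n => ∑ j ∈ Finset.range n, (-1 : ℝ) ^ j * depthCoeff (r + 1) s j) atTop
      (𝓝 ((-1) ^ (r + 1) * sumW (r + 1 + s) (r + 1))) := by
  rw [← tendsto_add_atTop_iff_nat 1]
  have h1 : Tendsto (fun i => ∑ k ∈ indexSet (r + 1 + s) (r + 1), altMTVPartialSum k (i + (r + 1)))
      atTop (𝓝 (sumW (r + 1 + s) (r + 1))) := by
    unfold sumW
    refine tendsto_finsetSum _ fun k hk => ?_
    exact (tendsto_add_atTop_iff_nat (r + 1)).2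
      (tendsto_altMTVPartialSum (one_le_of_mem_indexSet hk))
  refine (h1.const_mul _).congr fun i => ?_
  simp only [add_comm i (r + 1)]
  rw [sum_altMTVPartialSum, ← mul_assoc, ← mul_pow]
  simp

theorem sum_Icc_one_eq_sum_range (a : ℕ → ℝ) (n : ℕ) :
    ∑ j ∈ Finset.Icc 1 n, a j = ∑ j ∈ Finset.range n, a (j + 1) := by
  induction n with
  | zero => simp
  | succ n ih => rw [Finset.sum_Icc_succ_top (by omega), ih, Finset.sum_range_succ]

theorem logGrowth_onesTSum (r : ℕ) : LogGrowth (onesTSum r) := by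
  induction r with
  | zero =>
    rw [show onesTSum 0 = fun _ => 1 from funext onesTSum_zero]
    exact LogGrowth.const 1
  | succ r ih =>
    by_cases hr : Even r
    · have h1 := ((LogGrowth.const 2).mul ih.shift).div_pow le_rfl (le_refl 1)
      convert h1.logGrowth_sum_range using 2 with n
      rw [onesTSum_succ_of_even hr, sum_Icc_one_eq_sum_range]
      refine Finset.sum_congr rfl fun j _ => ?_
      push_cast
      rw [show 2 * ((j : ℝ) + 1) - 1 = 1 + 2 * j by ring]
      ring
    · have h1 : onesTSum (r + 1) =
          fun n => ∑ j ∈ Finset.range n, 2 / (2 * (j : ℝ)) * onesTSum r j := by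
        funext n
        rcases n with _ | n
        · simp [onesTSum_succ_zero]
        · rw [onesTSum_succ_of_odd hr, Finset.sum_range_succ', sum_Icc_one_eq_sum_range]
          simp
      rw [h1]
      obtain ⟨C, k, h⟩ := ih
      refine LogGrowth.sum_range (C := 2 * C) (k := k) fun n => ?_
      have h2 : |2 / (2 * (n : ℝ))| ≤ 2 / ((n : ℝ) + 1) := by
        rw [abs_of_nonneg (by positivity)]
        rcases n with _ | n
        · simp
        · rw [div_le_div_iff₀ (by positivity) (by positivity)]
          push_cast
          linarith [n.cast_nonneg (α := ℝ)]
      rw [abs_mul]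
      calc _ ≤ _ := mul_le_mul h2 (h n).1 (abs_nonneg _) (by positivity)
        _ = _ := by ring

/-! ### Powers of the logarithm -/

/-- `(-log t)^s / s!`. -/
noncomputable def logPow (s : ℕ) (t : ℝ) : ℝ := (-Real.log t) ^ s / s.factorial

theorem logPow_zero (t : ℝ) : logPow 0 t = 1 := by simp [logPow]

theorem logPow_succ_one (s : ℕ) : logPow (s + 1) 1 = 0 := by simp [logPow]

theorem logPow_nonneg {s : ℕ} {t : ℝ} (h0 : 0 ≤ t) (h1 : t ≤ 1) : 0 ≤ logPow s t := by
  have : 0 ≤ -Real.log t := by linarith [Real.log_nonpos h0 h1]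
  unfold logPow
  positivity

theorem hasDerivAt_logPow_succ (s : ℕ) {t : ℝ} (ht : t ≠ 0) :
    HasDerivAt (logPow (s + 1)) (-(logPow s t / t)) t := by
  unfold logPow
  refine (((Real.hasDerivAt_log ht).neg.pow (s + 1)).div_const
    ((s + 1).factorial : ℝ)).congr_deriv ?_
  rw [Nat.factorial_succ]
  have : (s.factorial : ℝ) ≠ 0 := by positivity
  push_cast
  simp only [Pi.neg_apply]
  field_simp

theorem continuousAt_logPow (s : ℕ) {t : ℝ} (ht : t ≠ 0) : ContinuousAt (logPow s) t := by
  unfold logPow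
  exact ((Real.continuousAt_log ht).neg.pow s).div_const _

theorem measurable_logPow (s : ℕ) : Measurable (logPow s) := by
  unfold logPow
  fun_prop

theorem logPow_le (s : ℕ) : ∃ C : ℝ, 0 ≤ C ∧ ∀ t : ℝ, 0 < t → t ≤ 1 →
    logPow s t ≤ C * t ^ (-(1 / 2) : ℝ) := by
  set ε : ℝ := 1 / (2 * (s + 1)) with hε
  have hε0 : 0 < ε := by positivity
  refine ⟨(1 / ε) ^ s, by positivity, fun t ht ht1 => ?_⟩
  have h0 : 0 ≤ -Real.log t := by linarith [Real.log_nonpos ht.le ht1]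
  have h1 : -Real.log t ≤ (1 / ε) * t ^ (-ε) := by
    have := Real.log_le_rpow_div (inv_nonneg.2 ht.le) hε0
    rwa [Real.log_inv, Real.inv_rpow ht.le, ← Real.rpow_neg ht.le, div_eq_inv_mul,
      ← one_div] at this
  calc logPow s t ≤ (-Real.log t) ^ s := by
        unfold logPow
        exact div_le_self (by positivity) (by exact_mod_cast s.factorial_pos)
    _ ≤ ((1 / ε) * t ^ (-ε)) ^ s := by gcongr
    _ = (1 / ε) ^ s * t ^ (-ε * s) := by
        rw [mul_pow, Real.rpow_mul ht.le, Real.rpow_natCast]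
    _ ≤ _ := by
        refine mul_le_mul_of_nonneg_left ?_ (by positivity)
        apply Real.rpow_le_rpow_of_exponent_ge ht ht1
        rw [neg_mul, neg_le_neg_iff, hε, div_mul_eq_mul_div,
          div_le_div_iff₀ (by positivity) (by positivity)]
        linarith

theorem intervalIntegrable_logPow (s : ℕ) :
    IntervalIntegrable (logPow s) MeasureTheory.volume 0 1 := by
  obtain ⟨C, hC, h⟩ := logPow_le s
  refine ((intervalIntegral.intervalIntegrable_rpow' (r := -(1 / 2)) (by norm_num)).const_mul
    C).mono_fun' (measurable_logPow s).aestronglyMeasurable ?_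
  refine (MeasureTheory.ae_restrict_iff' measurableSet_uIoc).2 (Eventually.of_forall fun t ht => ?_)
  rw [Set.uIoc_of_le zero_le_one] at ht
  dsimp only
  rw [Real.norm_eq_abs, abs_of_nonneg (logPow_nonneg ht.1.le ht.2)]
  exact h t ht.1 ht.2

theorem intervalIntegrable_mul_logPow (s : ℕ) {g : ℝ → ℝ} (hg : ContinuousOn g (Set.Icc 0 1)) :
    IntervalIntegrable (fun t => g t * logPow s t) MeasureTheory.volume 0 1 :=
  (intervalIntegrable_logPow s).continuousOn_mul (by rwa [Set.uIcc_of_le zero_le_one])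

theorem tendsto_mul_logPow_zero (s : ℕ) :
    Tendsto (fun t => t * logPow s t) (𝓝[>] 0) (𝓝 0) := by
  obtain ⟨C, hC, h⟩ := logPow_le s
  have h1 : Tendsto (fun t : ℝ => C * t ^ (1 / 2 : ℝ)) (𝓝[>] 0) (𝓝 0) := by
    have h2 : ContinuousAt (fun t : ℝ => C * t ^ (1 / 2 : ℝ)) 0 :=
      continuousAt_const.mul (Real.continuousAt_rpow_const _ _ (Or.inr (by norm_num)))
    have h3 := h2.tendsto
    simp only [Real.zero_rpow (by norm_num : (1 / 2 : ℝ) ≠ 0), mul_zero] at h3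
    exact h3.mono_left nhdsWithin_le_nhds
  have hmem : Set.Ioo (0 : ℝ) 1 ∈ 𝓝[>] (0 : ℝ) := Ioo_mem_nhdsGT one_pos
  refine squeeze_zero' ?_ ?_ h1
  · filter_upwards [hmem] with t ht
    exact mul_nonneg ht.1.le (logPow_nonneg ht.1.le ht.2.le)
  · filter_upwards [hmem] with t ht
    calc t * logPow s t ≤ t * (C * t ^ (-(1 / 2) : ℝ)) := by
          gcongr
          · exact ht.1.le
          · exact h t ht.1 ht.2.le
      _ = C * (t ^ (1 : ℝ) * t ^ (-(1 / 2) : ℝ)) := by rw [Real.rpow_one]; ring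
      _ = _ := by rw [← Real.rpow_add ht.1]; norm_num

theorem tendsto_logPow_succ_one (s : ℕ) : Tendsto (logPow (s + 1)) (𝓝[<] 1) (𝓝 0) := by
  have := (continuousAt_logPow (s + 1) one_ne_zero).tendsto
  rw [logPow_succ_one] at this
  exact this.mono_left nhdsWithin_le_nhds

/-- Integration by parts with t^{n+1} (-log t)^{s+1} / (s+1)!, whose boundary values vanish: each
power of the logarithm costs one factor 1/(n+1). -/
theorem integral_pow_mul_logPow (n s : ℕ) :
    ∫ t in (0 : ℝ)..1, t ^ n * logPow s t = 1 / ((n : ℝ) + 1) ^ (s + 1) := by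
  induction s with
  | zero => simp [logPow_zero]
  | succ s ih =>
    have hn : (n : ℝ) + 1 ≠ 0 := by positivity
    have hi := fun s => intervalIntegrable_mul_logPow s
      (continuous_pow n).continuousOn (g := fun t : ℝ => t ^ n)
    have h := intervalIntegral.integral_eq_sub_of_hasDerivAt_of_tendsto one_pos
      (f := fun t => t ^ (n + 1) * logPow (s + 1) t)
      (f' := fun t => ((n : ℝ) + 1) * (t ^ n * logPow (s + 1) t) - t ^ n * logPow s t)
      (fa := 0) (fb := 0) ?_ (((hi (s + 1)).const_mul _).sub (hi s)) ?_ ?_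
    · rw [intervalIntegral.integral_sub ((hi (s + 1)).const_mul _) (hi s),
        intervalIntegral.integral_const_mul, ih] at h
      rw [pow_succ, ← div_div, eq_div_iff hn]
      linarith
    · intro t ht
      refine ((hasDerivAt_pow (n + 1) t).mul (hasDerivAt_logPow_succ s ht.1.ne')).congr_deriv ?_
      have := ht.1.ne'
      simp only [Nat.add_sub_cancel]
      push_cast
      field_simp
      ring
    · have h1 : Tendsto (fun t : ℝ => t ^ n) (𝓝[>] 0) (𝓝 (0 ^ n)) :=
        ((continuous_pow n).tendsto 0).mono_left nhdsWithin_le_nhds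
      have := h1.mul (tendsto_mul_logPow_zero (s + 1))
      rw [mul_zero] at this
      refine this.congr fun t => ?_
      ring
    · have h1 : Tendsto (fun t : ℝ => t ^ (n + 1)) (𝓝[<] 1) (𝓝 (1 ^ (n + 1))) :=
        ((continuous_pow (n + 1)).tendsto 1).mono_left nhdsWithin_le_nhds
      simpa using h1.mul (tendsto_logPow_succ_one s)

theorem integral_logPow_div_one_add (s : ℕ) :
    ∫ t in (0 : ℝ)..1, 1 / (1 + t) * logPow s t = altZeta (s + 1) := by
  have hc : ContinuousOn (fun t : ℝ => 1 / (1 + t)) (Set.Icc 0 1) := by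
    refine continuousOn_const.div (by fun_prop) fun t ht => ?_
    linarith [ht.1]
  have hi := intervalIntegrable_mul_logPow s hc
  have hsum : ∀ N, altZetaPartialSum (s + 1) N =
      ∫ t in (0 : ℝ)..1, (∑ n ∈ Finset.range N, (-t) ^ n) * logPow s t := by
    intro N
    simp only [Finset.sum_mul]
    rw [intervalIntegral.integral_finsetSum]
    · unfold altZetaPartialSum
      rw [sum_Icc_one_eq_sum_range]
      refine Finset.sum_congr rfl fun n _ => ?_
      have h : ∀ t : ℝ, (-t) ^ n * logPow s t = (-1) ^ n * (t ^ n * logPow s t) := by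
        intro t
        rw [neg_pow, mul_assoc]
      simp only [h]
      rw [intervalIntegral.integral_const_mul, integral_pow_mul_logPow]
      simp [div_eq_mul_inv]
    · intro n _
      exact intervalIntegrable_mul_logPow s (by fun_prop)
  -- The remainder of the finite geometric series is (-t)^N / (1 + t), at most t^N in absolute
  -- value. This covers the conditionally convergent case s = 0 as well.
  have hrem : ∀ N, |(∫ t in (0 : ℝ)..1, 1 / (1 + t) * logPow s t) - altZetaPartialSum (s + 1) N| ≤
      1 / ((N : ℝ) + 1) := by
    intro N
    have hcont : ContinuousOn (fun t : ℝ => ∑ n ∈ Finset.range N, (-t) ^ n) (Set.Icc 0 1) := by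
      fun_prop
    rw [hsum, ← intervalIntegral.integral_sub hi (intervalIntegrable_mul_logPow s hcont)]
    have hpow := intervalIntegrable_mul_logPow s
      (continuous_pow N).continuousOn (g := fun t : ℝ => t ^ N)
    rw [← Real.norm_eq_abs]
    refine (intervalIntegral.norm_integral_le_of_norm_le zero_le_one
      (Eventually.of_forall fun t ht => ?_) hpow).trans ?_
    · have h0 := logPow_nonneg (s := s) ht.1.le ht.2
      have h1 : (0 : ℝ) < 1 + t := by linarith [ht.1]
      have h2 : 1 / (1 + t) - ∑ n ∈ Finset.range N, (-t) ^ n = (-t) ^ N / (1 + t) := by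
        have := mul_neg_geom_sum (-t) N
        rw [sub_neg_eq_add] at this
        field_simp
        linarith
      rw [← sub_mul, h2, norm_mul, Real.norm_of_nonneg h0]
      gcongr
      rw [norm_div, norm_pow, norm_neg, Real.norm_of_nonneg ht.1.le, Real.norm_of_nonneg h1.le]
      exact div_le_self (pow_nonneg ht.1.le _) (by linarith [ht.1])
    · rw [integral_pow_mul_logPow]
      gcongr
      exact le_self_pow₀ (by linarith [N.cast_nonneg (α := ℝ)]) (by omega)
  have hlim : Tendsto (altZetaPartialSum (s + 1)) atTop
      (𝓝 (∫ t in (0 : ℝ)..1, 1 / (1 + t) * logPow s t)) := by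
    rw [tendsto_iff_norm_sub_tendsto_zero]
    refine squeeze_zero (fun _ => norm_nonneg _) (fun N => ?_)
      tendsto_one_div_add_atTop_nhds_zero_nat
    rw [norm_sub_rev]
    exact hrem N
  exact tendsto_nhds_unique hlim (tendsto_altZetaPartialSum (by omega))

/-! ### Moments of powers of the logarithm with respect to `(1 - t) / (1 + t)` -/

/-- The involution `t ↦ (1 - t) / (1 + t)` of the unit interval. -/
noncomputable def cayley (t : ℝ) : ℝ := (1 - t) / (1 + t)

theorem hasDerivAt_cayley {t : ℝ} (ht : 1 + t ≠ 0) :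
    HasDerivAt cayley (-(2 / (1 + t) ^ 2)) t := by
  unfold cayley
  refine (((hasDerivAt_id t).const_sub 1).div ((hasDerivAt_id t).const_add 1) ht).congr_deriv ?_
  simp only [id]
  field_simp
  ring

theorem continuousOn_cayley : ContinuousOn cayley (Set.Icc 0 1) := fun t ht =>
  (hasDerivAt_cayley (by linarith [ht.1])).continuousAt.continuousWithinAt

theorem cayley_zero : cayley 0 = 1 := by simp [cayley]

theorem cayley_one : cayley 1 = 0 := by simp [cayley]

theorem cayley_nonneg {t : ℝ} (h0 : 0 ≤ t) (h1 : t ≤ 1) : 0 ≤ cayley t :=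
  div_nonneg (by linarith) (by linarith)

theorem cayley_lt_one {t : ℝ} (h0 : 0 < t) : cayley t < 1 := by
  rw [cayley, div_lt_one (by linarith)]
  linarith

/-- `n ∫_0^1 x^{n-1} (log ((1+x)/(1-x)))^s / s! dx`, in the variable `t = (1-x)/(1+x)`. -/
noncomputable def cayleyMoment (s n : ℕ) : ℝ :=
  ∫ t in (0 : ℝ)..1, n * cayley t ^ (n - 1) * (2 / (1 + t) ^ 2) * logPow s t

theorem continuousOn_cayleyMoment (n : ℕ) :
    ContinuousOn (fun t => n * cayley t ^ (n - 1) * (2 / (1 + t) ^ 2)) (Set.Icc 0 1) := by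
  refine (continuousOn_const.mul (continuousOn_cayley.pow _)).mul
    (continuousOn_const.div (by fun_prop) fun t ht => ?_)
  have := ht.1
  positivity

theorem hasDerivAt_one_sub_cayley_pow (n : ℕ) {t : ℝ} (ht : 0 < t) :
    HasDerivAt (fun t => 1 - cayley t ^ n) (n * cayley t ^ (n - 1) * (2 / (1 + t) ^ 2)) t := by
  refine (((hasDerivAt_cayley (t := t) (by linarith)).pow n).const_sub 1).congr_deriv ?_
  ring

theorem cayleyMoment_zero_right (s : ℕ) : cayleyMoment s 0 = 0 := by simp [cayleyMoment]

theorem cayleyMoment_zero_left (n : ℕ) : cayleyMoment 0 (n + 1) = 1 := by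
  have h := intervalIntegral.integral_eq_sub_of_hasDerivAt_of_tendsto one_pos
    (f := fun t => 1 - cayley t ^ (n + 1)) (fa := 0) (fb := 1)
    (fun t ht => hasDerivAt_one_sub_cayley_pow (n + 1) ht.1)
    ((continuousOn_cayleyMoment (n + 1)).intervalIntegrable_of_Icc zero_le_one) ?_ ?_
  · simp only [cayleyMoment, logPow_zero, mul_one, h, sub_zero]
  · have := (hasDerivAt_cayley (t := 0) (by norm_num)).continuousAt.tendsto
    rw [cayley_zero] at this
    simpa using ((this.pow (n + 1)).const_sub 1).mono_left nhdsWithin_le_nhds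
  · have := (hasDerivAt_cayley (t := 1) (by norm_num)).continuousAt.tendsto
    rw [cayley_one] at this
    simpa using ((this.pow (n + 1)).const_sub 1).mono_left nhdsWithin_le_nhds

theorem continuousOn_geom_sum_cayley (n : ℕ) :
    ContinuousOn (fun t => 2 / (1 + t) * ∑ i ∈ Finset.range n, cayley t ^ i) (Set.Icc 0 1) := by
  refine ContinuousOn.mul (continuousOn_const.div (by fun_prop) fun t ht => ?_)
    (continuousOn_finsetSum _ fun i _ => continuousOn_cayley.pow i)
  linarith [ht.1]

theorem one_sub_cayley_pow (n : ℕ) {t : ℝ} (ht : 0 ≤ t) :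
    1 - cayley t ^ n = t * (2 / (1 + t) * ∑ i ∈ Finset.range n, cayley t ^ i) := by
  rw [← mul_neg_geom_sum, ← mul_assoc]
  congr 1
  unfold cayley
  have : 1 + t ≠ 0 := by linarith
  field_simp
  ring

/-- Integration by parts, with the primitive of the weight normalized to 1 - c^n, c = (1-t)/(1+t).
It vanishes at t = 0, and its factor t cancels the 1/t coming from the logarithm. -/
theorem cayleyMoment_succ_left (s n : ℕ) :
    cayleyMoment (s + 1) n =
      ∫ t in (0 : ℝ)..1, 2 / (1 + t) * (∑ i ∈ Finset.range n, cayley t ^ i) * logPow s t := by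
  have h1 := intervalIntegrable_mul_logPow (s + 1) (continuousOn_cayleyMoment n)
  have h2 := intervalIntegrable_mul_logPow s (continuousOn_geom_sum_cayley n)
  have h := intervalIntegral.integral_eq_sub_of_hasDerivAt_of_tendsto one_pos
    (f := fun t => (1 - cayley t ^ n) * logPow (s + 1) t)
    (f' := fun t => n * cayley t ^ (n - 1) * (2 / (1 + t) ^ 2) * logPow (s + 1) t -
      2 / (1 + t) * (∑ i ∈ Finset.range n, cayley t ^ i) * logPow s t)
    (fa := 0) (fb := 0) ?_ (h1.sub h2) ?_ ?_
  · rw [intervalIntegral.integral_sub h1 h2] at h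
    unfold cayleyMoment
    linarith
  · intro t ht
    refine ((hasDerivAt_one_sub_cayley_pow n ht.1).mul
      (hasDerivAt_logPow_succ s ht.1.ne')).congr_deriv ?_
    rw [one_sub_cayley_pow n ht.1.le]
    have := ht.1.ne'
    field_simp
    ring
  · have h3 := ((continuousOn_geom_sum_cayley n) 0 (by simp)).mono_left
      (nhdsWithin_le_of_mem (mem_of_superset (Ioo_mem_nhdsGT one_pos) Set.Ioo_subset_Icc_self))
    have h4 := h3.mul (tendsto_mul_logPow_zero (s + 1))
    rw [mul_zero] at h4
    refine h4.congr' ?_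
    filter_upwards [self_mem_nhdsWithin] with t ht
    rw [one_sub_cayley_pow n (le_of_lt ht)]
    ring
  · have h3 := (hasDerivAt_one_sub_cayley_pow n one_pos).continuousAt.tendsto.mono_left
      (nhdsWithin_le_nhds (s := Set.Iio 1))
    have h4 := h3.mul (tendsto_logPow_succ_one s)
    rwa [mul_zero] at h4

/-- With c = (1-t)/(1+t) the two geometric sums differ by c^n + c^{n+1} = c^n · 2/(1+t), which
restores the weight of the moment of order s at n + 1. -/
theorem cayleyMoment_succ_add_two (s n : ℕ) :
    cayleyMoment (s + 1) (n + 2) =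
      cayleyMoment (s + 1) n + 2 / ((n : ℝ) + 1) * cayleyMoment s (n + 1) := by
  rw [cayleyMoment_succ_left, cayleyMoment_succ_left, cayleyMoment,
    ← intervalIntegral.integral_const_mul, ← intervalIntegral.integral_add]
  · refine intervalIntegral.integral_congr fun t ht => ?_
    rw [Set.uIcc_of_le zero_le_one] at ht
    have h1 : 1 + t ≠ 0 := by linarith [ht.1]
    have h2 : (n : ℝ) + 1 ≠ 0 := by positivity
    simp only [Finset.sum_range_succ, Nat.add_sub_cancel]
    push_cast
    rw [pow_succ, show cayley t ^ n * cayley t = cayley t ^ n * (2 / (1 + t)) - cayley t ^ n by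
      unfold cayley
      field_simp
      ring]
    field_simp
    ring
  · exact intervalIntegrable_mul_logPow s (continuousOn_geom_sum_cayley n)
  · exact (intervalIntegrable_mul_logPow s (continuousOn_cayleyMoment (n + 1))).const_mul _

theorem cayleyMoment_succ_one (s : ℕ) : cayleyMoment (s + 1) 1 = 2 * altZeta (s + 1) := by
  rw [cayleyMoment_succ_left, ← integral_logPow_div_one_add, ← intervalIntegral.integral_const_mul]
  refine intervalIntegral.integral_congr fun t _ => ?_
  simp
  ring

/-! ### The linear system between logarithmic moments and `T`-harmonic sums, and its inversion by
`Z` -/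

theorem onesTSum_odd_succ (l n : ℕ) :
    onesTSum (2 * l + 1) (n + 1) =
      onesTSum (2 * l + 1) n + 2 / (2 * (n : ℝ) + 1) * onesTSum (2 * l) (n + 1) := by
  rw [onesTSum_succ_of_even (by simp), onesTSum_succ_of_even (by simp),
    Finset.sum_Icc_succ_top (by omega)]
  push_cast
  rw [show 2 * ((n : ℝ) + 1) - 1 = 2 * n + 1 by ring]

theorem onesTSum_even_succ (l n : ℕ) :
    onesTSum (2 * l + 2) (n + 2) =
      onesTSum (2 * l + 2) (n + 1) + 2 / (2 * (n : ℝ) + 2) * onesTSum (2 * l + 1) (n + 1) := by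
  rw [onesTSum_succ_of_odd (by simp), onesTSum_succ_of_odd (by simp),
    Finset.sum_Icc_succ_top (by omega)]
  push_cast
  rw [mul_add, mul_one]

/-- Both sides satisfy the same recursion in n, which alternates between the two parities. At n = 0
the even moments supply the constants and the odd ones are 0, so a single induction handles both
statements. -/
theorem cayleyMoment_eq_sum (n : ℕ) :
    (∀ p, cayleyMoment (2 * p) (2 * n + 1) =
      ∑ q ∈ Finset.range (p + 1), cayleyMoment (2 * q) 1 * onesTSum (2 * (p - q)) (n + 1)) ∧
    ∀ p, cayleyMoment (2 * p + 1) (2 * n) =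
      ∑ q ∈ Finset.range (p + 1), cayleyMoment (2 * q) 1 * onesTSum (2 * (p - q) + 1) n := by
  have h0 : ∀ n, ∑ q ∈ Finset.range (0 + 1),
      cayleyMoment (2 * q) 1 * onesTSum (2 * (0 - q)) (n + 1) = 1 := by
    intro n
    simp [cayleyMoment_zero_left 0, onesTSum_zero]
  have hsub : ∀ p q, q ∈ Finset.range (p + 1) → 2 * (p + 1 - q) = 2 * (p - q) + 2 := by
    intro p q hq
    rw [Finset.mem_range] at hq
    omega
  induction n with
  | zero =>
    refine ⟨fun p => ?_, fun p => ?_⟩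
    · rcases p with _ | p
      · rw [h0]
        exact cayleyMoment_zero_left 0
      · rw [Finset.sum_range_succ, Finset.sum_eq_zero]
        · simp [onesTSum_zero]
        · intro q hq
          rw [hsub p q hq, onesTSum_succ_of_odd (by simp)]
          simp
    · simp [cayleyMoment_zero_right, onesTSum_succ_zero]
  | succ n ih =>
    have hodd : ∀ p, cayleyMoment (2 * p + 1) (2 * (n + 1)) =
        ∑ q ∈ Finset.range (p + 1), cayleyMoment (2 * q) 1 * onesTSum (2 * (p - q) + 1) (n + 1) := by
      intro p
      rw [show 2 * (n + 1) = 2 * n + 2 by ring, cayleyMoment_succ_add_two, ih.2, ih.1,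
        Finset.mul_sum, ← Finset.sum_add_distrib]
      refine Finset.sum_congr rfl fun q _ => ?_
      rw [onesTSum_odd_succ]
      push_cast
      ring
    refine ⟨fun p => ?_, hodd⟩
    rcases p with _ | p
    · rw [h0]
      exact cayleyMoment_zero_left _
    · rw [show 2 * (n + 1) + 1 = (2 * n + 1) + 2 by ring, show 2 * (p + 1) = (2 * p + 1) + 1 by ring,
        cayleyMoment_succ_add_two, show 2 * p + 1 + 1 = 2 * (p + 1) by ring, ih.1,
        show 2 * n + 1 + 1 = 2 * (n + 1) by ring, hodd, Finset.sum_range_succ,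
        Finset.sum_range_succ _ (p + 1), Finset.mul_sum, add_right_comm, ← Finset.sum_add_distrib]
      congr 1
      · refine Finset.sum_congr rfl fun q hq => ?_
        rw [hsub p q hq, onesTSum_even_succ]
        push_cast
        rw [add_assoc, one_add_one_eq_two]
        ring
      · simp [onesTSum_zero]

/-- The recursion for Z read as a matrix inverse: the moments at 1 are 1 on the diagonal and 2
ζ̄(2d) at distance d > 0 from it. -/
theorem sum_coeffZ_mul_cayleyMoment_one {l p : ℕ} (hl : l < p) :
    ∑ j ∈ Finset.Ico l p, coeffZ (j + 1) p * cayleyMoment (2 * (j - l)) 1 =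
      if l + 1 = p then 1 else 0 := by
  rw [Finset.sum_eq_sum_Ico_succ_bot hl]
  simp only [Nat.sub_self, mul_zero, cayleyMoment_zero_left 0, mul_one]
  split_ifs with h
  · subst h
    simp [coeffZ_self]
  · have hIoc : Finset.Ioc (l + 1) p = Finset.Ico (l + 1 + 1) (p + 1) := by
      ext q
      simp
    rw [coeffZ_of_lt (by omega), hIoc, ← Finset.sum_Ico_add', Finset.mul_sum,
      ← Finset.sum_add_distrib]
    refine Finset.sum_eq_zero fun j hj => ?_
    rw [Finset.mem_Ico] at hj
    obtain ⟨d, rfl⟩ : ∃ d, j = l + 1 + d := ⟨j - (l + 1), by omega⟩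
    rw [show 2 * (l + 1 + d - l) = 2 * d + 1 + 1 by omega, cayleyMoment_succ_one,
      show 2 * (l + 1 + d + 1) - 2 * (l + 1) = 2 * d + 1 + 1 by omega]
    ring

theorem onesTSum_eq_sum_cayleyMoment (p n : ℕ) :
    onesTSum (2 * p + 1) n =
      ∑ j ∈ Finset.range (p + 1), coeffZ (j + 1) (p + 1) * cayleyMoment (2 * j + 1) (2 * n) := by
  have h : ∀ j, cayleyMoment (2 * j + 1) (2 * n) = ∑ l ∈ Finset.range (j + 1),
      cayleyMoment (2 * (j - l)) 1 * onesTSum (2 * l + 1) n := by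
    intro j
    rw [(cayleyMoment_eq_sum n).2, ← Finset.sum_range_reflect]
    refine Finset.sum_congr rfl fun q hq => ?_
    rw [Finset.mem_range] at hq
    rw [show j + 1 - 1 - q = j - q by omega, show j - (j - q) = q by omega]
  simp only [h, Finset.mul_sum]
  rw [Finset.sum_comm' (t' := Finset.range (p + 1)) (s' := fun l => Finset.Ico l (p + 1))]
  · rw [Finset.sum_range_succ, Finset.sum_eq_zero]
    · simp [coeffZ_self, cayleyMoment_zero_left 0]
    · intro l hl
      rw [Finset.mem_range] at hl
      have := sum_coeffZ_mul_cayleyMoment_one (l := l) (p := p + 1) (by omega)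
      rw [if_neg (by omega)] at this
      simp only [← mul_assoc, ← Finset.sum_mul, this, zero_mul]
  · intro x y
    simp only [Finset.mem_range, Finset.mem_Ico]
    omega

/-! ### The power series attached to the sums `W` -/

theorem summable_mul_pow_of_bound {c : ℕ → ℝ} {C : ℝ} (hc : ∀ i : ℕ, |c i| ≤ C * ((i : ℝ) + 1) ^ 2)
    {y : ℝ} (hy : |y| < 1) : Summable fun i => |c i| * |y| ^ i := by
  have h : ∀ k, Summable fun i : ℕ => (i : ℝ) ^ k * |y| ^ i := fun k =>
    summable_pow_mul_geometric_of_norm_lt_one k (by simpa using hy)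
  have h2 : Summable fun i : ℕ => C * (((i : ℝ) + 1) ^ 2 * |y| ^ i) := by
    refine Summable.mul_left _ ((((h 2).add ((h 1).mul_left 2)).add (h 0)).congr fun i => ?_)
    ring
  refine Summable.of_nonneg_of_le (fun i => by positivity) (fun i => ?_) h2
  rw [← mul_assoc]
  gcongr
  exact hc i

theorem summable_mul_pow_of_linear_bound {c : ℕ → ℝ} {C : ℝ}
    (hc : ∀ i : ℕ, |c i| ≤ C * ((i : ℝ) + 1)) {y : ℝ} (hy : |y| < 1) :
    Summable fun i => |c i| * |y| ^ i := by
  refine summable_mul_pow_of_bound (C := C) (fun i => (hc i).trans ?_) hy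
  have hC : 0 ≤ C := by simpa using (abs_nonneg _).trans (hc 0)
  gcongr
  exact le_self_pow₀ (by linarith [i.cast_nonneg (α := ℝ)]) two_ne_zero

theorem abs_neg_one_pow_mul (i : ℕ) (x : ℝ) : |(-1) ^ i * x| = |x| := by
  rw [abs_mul, abs_pow, abs_neg, abs_one, one_pow, one_mul]

theorem summable_depthCoeff (r s : ℕ) {y : ℝ} (hy : |y| < 1) :
    Summable fun i => (-1) ^ i * depthCoeff r s i * y ^ i := by
  obtain ⟨C, hC⟩ := exists_bound_depthCoeff r s
  refine Summable.of_norm ((summable_mul_pow_of_linear_bound hC hy).congr fun i => ?_)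
  rw [Real.norm_eq_abs, abs_mul, abs_neg_one_pow_mul, abs_pow]

theorem summable_depthSum (r s : ℕ) {y : ℝ} (hy : |y| < 1) :
    Summable fun i => (-1) ^ i * depthSum r s i * y ^ i := by
  obtain ⟨C, hC⟩ := (logGrowth_depthSum r s).exists_bound
  refine Summable.of_norm ((summable_mul_pow_of_linear_bound hC hy).congr fun i => ?_)
  rw [Real.norm_eq_abs, abs_mul, abs_neg_one_pow_mul, abs_pow]

/-- Partial summation is division by 1 - y in a generating function; the alternating signs change
this to 1 + y. -/
theorem tsum_depthSum (r s : ℕ) {y : ℝ} (hy : |y| < 1) :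
    ∑' i, (-1) ^ i * depthSum r s i * y ^ i =
      (∑' i, (-1) ^ i * depthCoeff r s i * y ^ i) / (1 + y) := by
  have hy' : 1 + y ≠ 0 := by linarith [(abs_lt.1 hy).1]
  have h1 := summable_depthSum r s hy
  have h1' := (summable_nat_add_iff 1).2 h1
  rw [eq_div_iff hy', mul_add, mul_one, ← tsum_mul_right, h1.tsum_eq_zero_add,
    (summable_depthCoeff r s hy).tsum_eq_zero_add, add_assoc,
    ← h1'.tsum_add (h1.mul_right y)]
  congr 1
  · simp [depthSum]
  · refine tsum_congr fun i => ?_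
    rw [depthSum, depthSum, Finset.sum_range_succ _ (i + 1)]
    ring

/-- The power series `∑_i (-1)^i e_{r,s}(i) x^{r+2i}`. -/
noncomputable def depthSeries (r s : ℕ) (x : ℝ) : ℝ :=
  ∑' i, (-1) ^ i * depthCoeff r s i * x ^ (r + 2 * i)

theorem depthSeries_eq (r s : ℕ) (x : ℝ) :
    depthSeries r s x = x ^ r * ∑' i, (-1) ^ i * depthCoeff r s i * (x ^ 2) ^ i := by
  rw [depthSeries, ← tsum_mul_left]
  refine tsum_congr fun i => ?_
  rw [pow_add, pow_mul]
  ring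

theorem abs_sq_lt_one {x : ℝ} (hx : |x| < 1) : |x ^ 2| < 1 := by
  rw [abs_pow]
  exact pow_lt_one₀ (abs_nonneg _) hx two_ne_zero

theorem pow_mul_tsum_depthSum (r s : ℕ) {x : ℝ} (hx : |x| < 1) :
    x ^ r * ∑' i, (-1) ^ i * depthSum r s i * (x ^ 2) ^ i = depthSeries r s x / (1 + x ^ 2) := by
  rw [tsum_depthSum r s (abs_sq_lt_one hx), depthSeries_eq, mul_div_assoc]

theorem depthSeries_zero_left (s : ℕ) (x : ℝ) : depthSeries 0 s x = if s = 0 then 1 else 0 := by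
  rw [depthSeries]
  rcases s with _ | s
  · rw [tsum_eq_single 0]
    · simp [depthCoeff]
    · intro i hi
      simp [depthCoeff, hi]
  · simp [depthCoeff]

theorem depthSeries_succ_zero (r s : ℕ) : depthSeries (r + 1) s 0 = 0 := by
  simp [depthSeries_eq]

theorem hasDerivAt_depthSeries (r s : ℕ) {x : ℝ} (hx : |x| < 1) :
    HasDerivAt (depthSeries (r + 1) s) (∑' i : ℕ, (-1) ^ i * depthCoeff (r + 1) s i *
      ((r : ℝ) + 1 + 2 * i) * x ^ (r + 2 * i)) x := by
  obtain ⟨C, hC⟩ := exists_bound_depthCoeff (r + 1) s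
  have hC0 : 0 ≤ C := by simpa using (abs_nonneg _).trans (hC 0)
  -- A radius strictly between |x| and 1 makes the differentiated series dominated uniformly on a
  -- ball around 0.
  obtain ⟨ρ, hxρ, hρ⟩ := exists_between hx
  have hρ0 : 0 < ρ := (abs_nonneg x).trans_lt hxρ
  have hu : Summable fun i : ℕ =>
      |(-1) ^ i * depthCoeff (r + 1) s i * ((r : ℝ) + 1 + 2 * i)| * |ρ ^ 2| ^ i := by
    refine summable_mul_pow_of_bound (C := C * (r + 2)) (fun i => ?_)
      (abs_sq_lt_one (by rwa [abs_of_pos hρ0]))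
    rw [abs_mul, abs_neg_one_pow_mul, abs_of_nonneg (a := (r : ℝ) + 1 + 2 * i) (by positivity)]
    have h1 : (r : ℝ) + 1 + 2 * i ≤ (r + 2) * (i + 1) := by
      nlinarith [mul_nonneg (r.cast_nonneg (α := ℝ)) (i.cast_nonneg (α := ℝ))]
    calc _ ≤ (C * ((i : ℝ) + 1)) * ((r + 2) * (i + 1)) := by
          gcongr
          exact hC i
      _ = _ := by ring
  unfold depthSeries
  refine hasDerivAt_tsum_of_isPreconnected (𝕜 := ℝ)
    (g := fun i x => (-1) ^ i * depthCoeff (r + 1) s i * x ^ (r + 1 + 2 * i))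
    (g' := fun i x => (-1) ^ i * depthCoeff (r + 1) s i * ((r : ℝ) + 1 + 2 * i) * x ^ (r + 2 * i))
    (t := Metric.ball (0 : ℝ) ρ) (y₀ := (0 : ℝ)) hu Metric.isOpen_ball
    (convex_ball _ _).isPreconnected (fun i y _ => ?_) (fun i y hy => ?_)
    (Metric.mem_ball_self hρ0) ?_ (by simpa using hxρ)
  · have h1 := (hasDerivAt_pow (r + 1 + 2 * i) y).const_mul ((-1) ^ i * depthCoeff (r + 1) s i)
    refine h1.congr_deriv ?_
    rw [show r + 1 + 2 * i - 1 = r + 2 * i by omega]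
    push_cast
    ring
  · rw [Real.norm_eq_abs, abs_mul]
    refine mul_le_mul_of_nonneg_left ?_ (abs_nonneg _)
    have hy' : |y| < ρ := by simpa using hy
    rw [abs_of_nonneg (sq_nonneg ρ), abs_pow, pow_add, pow_mul]
    calc |y| ^ r * (|y| ^ 2) ^ i ≤ 1 * (ρ ^ 2) ^ i := by
          gcongr
          exact pow_le_one₀ (abs_nonneg _) (hy'.le.trans hρ.le)
      _ = _ := one_mul _
  · refine summable_zero.congr fun i => ?_
    rw [zero_pow (by omega), mul_zero]

/-- The sequence `0, g 0, g 1, …`. -/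
def delay (g : ℕ → ℝ) : ℕ → ℝ
  | 0 => 0
  | n + 1 => g n

/-- This and the next identity are the two cancellations in the telescoping antiderivative: in the
weight direction everything cancels, in the depth direction one end term survives. -/
theorem sum_delay_mul (f g : ℕ → ℝ) (n : ℕ) :
    ∑ j ∈ Finset.range (n + 1), delay f j * g (n - j) =
      ∑ j ∈ Finset.range (n + 1), f j * delay g (n - j) := by
  rw [Finset.sum_range_succ', Finset.sum_range_succ _ n]
  simp only [delay, zero_mul, Nat.sub_self, mul_zero, add_zero]
  refine Finset.sum_congr rfl fun j hj => ?_
  rw [Finset.mem_range] at hj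
  rw [show n - j = n - (j + 1) + 1 by omega]

theorem sum_mul_sub_sum_delay (f g : ℕ → ℝ) (n : ℕ) :
    ∑ i ∈ Finset.range (n + 1), f i * g (n - i) -
      ∑ i ∈ Finset.range (n + 1), f (i + 1) * delay g (n - i) = f 0 * g n := by
  rw [Finset.sum_range_succ', Finset.sum_range_succ _ n]
  simp only [delay, Nat.sub_self, mul_zero, add_zero, Nat.sub_zero]
  rw [sub_eq_iff_eq_add, add_comm]
  congr 1
  refine Finset.sum_congr rfl fun j hj => ?_
  rw [Finset.mem_range] at hj
  rw [show n - j = n - (j + 1) + 1 by omega]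

theorem depthCoeff_mul (r s i : ℕ) : depthCoeff (r + 1) s i * ((r : ℝ) + 1 + 2 * i) =
    delay (fun s => depthCoeff (r + 1) s i) s + 2 * depthSum r s i := by
  have : (r : ℝ) + 1 + 2 * i ≠ 0 := by positivity
  rcases s with _ | s
  · rw [depthCoeff, div_mul_cancel₀ _ this, delay, zero_add, depthSum]
  · rw [depthCoeff, div_mul_cancel₀ _ this, delay, depthSum]

/-- Termwise, the factor r + 1 + 2i undoes one division in the recursion of the coefficients. For s
= 0 the term with 1/x is absent, so x = 0 is allowed there. -/
theorem hasDerivAt_depthSeries_succ (r s : ℕ) {x : ℝ} (hx : |x| < 1) (h : x ≠ 0 ∨ s = 0) :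
    HasDerivAt (depthSeries (r + 1) s) (delay (fun s => depthSeries (r + 1) s x) s / x +
      2 / (1 + x ^ 2) * depthSeries r s x) x := by
  refine (hasDerivAt_depthSeries r s hx).congr_deriv ?_
  have hx2 := abs_sq_lt_one hx
  have h1 : ∀ i : ℕ, (-1) ^ i * depthCoeff (r + 1) s i * ((r : ℝ) + 1 + 2 * i) * x ^ (r + 2 * i) =
      x ^ r * ((-1) ^ i * delay (fun s => depthCoeff (r + 1) s i) s * (x ^ 2) ^ i) +
        2 * x ^ r * ((-1) ^ i * depthSum r s i * (x ^ 2) ^ i) := by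
    intro i
    rw [mul_assoc ((-1 : ℝ) ^ i), depthCoeff_mul, pow_add, pow_mul]
    ring
  have h2 : Summable fun i => (-1) ^ i * delay (fun s => depthCoeff (r + 1) s i) s * (x ^ 2) ^ i := by
    rcases s with _ | s
    · simp [delay]
    · exact summable_depthCoeff (r + 1) s hx2
  rw [tsum_congr h1, (h2.mul_left _).tsum_add ((summable_depthSum r s hx2).mul_left _),
    tsum_mul_left, tsum_mul_left]
  congr 1
  · rcases s with _ | s
    · simp [delay]
    · have hx0 : x ≠ 0 := by simpa using h
      simp only [delay]
      rw [depthSeries_eq, pow_succ]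
      field_simp
      ring
  · rw [mul_assoc, pow_mul_tsum_depthSum r s hx]
    ring

/-- For s = 0 the differential equation is F_{r+1}' = 2/(1+x^2) F_r with F_{r+1}(0) = 0, which the
powers of 2 arctan x satisfy as well. -/
theorem depthSeries_zero_right (r : ℕ) {x : ℝ} (h0 : 0 ≤ x) (h1 : x < 1) :
    depthSeries r 0 x = (2 * Real.arctan x) ^ r / r.factorial := by
  induction r generalizing x with
  | zero => simp [depthSeries_zero_left]
  | succ r ih =>
    have hd : ∀ y ∈ Set.Icc 0 x, HasDerivAt (fun y => depthSeries (r + 1) 0 y -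
        (2 * Real.arctan y) ^ (r + 1) / (r + 1).factorial) 0 y := by
      intro y hy
      have hy1 : |y| < 1 := by
        rw [abs_of_nonneg hy.1]
        exact hy.2.trans_lt h1
      have h2 := hasDerivAt_depthSeries_succ r 0 hy1 (Or.inr rfl)
      have h3 := (((Real.hasDerivAt_arctan y).const_mul 2).pow (r + 1)).div_const
        ((r + 1).factorial : ℝ)
      refine (h2.sub h3).congr_deriv ?_
      rw [ih hy.1 (hy.2.trans_lt h1), delay, Nat.factorial_succ]
      have : (r.factorial : ℝ) ≠ 0 := by positivity
      have : (1 + y ^ 2 : ℝ) ≠ 0 := by positivity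
      simp only [Nat.add_sub_cancel]
      push_cast
      field_simp
      ring
    have := constant_of_has_deriv_right_zero
      (fun y hy => (hd y hy).continuousAt.continuousWithinAt)
      (fun y hy => (hd y (Set.Ico_subset_Icc_self hy)).hasDerivWithinAt) x ⟨h0, le_rfl⟩
    simp only [depthSeries_succ_zero, Real.arctan_zero] at this
    simp only [mul_zero, ne_eq, Nat.add_eq_zero_iff, one_ne_zero, and_false, not_false_eq_true,
      zero_pow, zero_div, sub_self] at this
    linarith

theorem tendsto_sq_nhdsLT_one : Tendsto (fun x : ℝ => x ^ 2) (𝓝[<] 1) (𝓝[<] 1) := by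
  refine tendsto_nhdsWithin_iff.2 ⟨?_, ?_⟩
  · have := ((continuous_pow 2).tendsto (1 : ℝ)).mono_left (nhdsWithin_le_nhds (s := Set.Iio 1))
    simpa using this
  · filter_upwards [Ioo_mem_nhdsLT (zero_lt_one (α := ℝ))] with x hx
    exact pow_lt_one₀ hx.1.le hx.2 two_ne_zero

/-- Abel's limit theorem in the variable x^2, applied to the alternating series for W. -/
theorem tendsto_depthSeries_one (r s : ℕ) :
    Tendsto (depthSeries (r + 1) s) (𝓝[<] 1)
      (𝓝 ((-1) ^ (r + 1) * sumW (r + 1 + s) (r + 1))) := by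
  have h1 := (Real.tendsto_tsum_powerSeries_nhdsWithin_lt
    (tendsto_alternating_depthCoeff r s)).comp tendsto_sq_nhdsLT_one
  have h2 : Tendsto (fun x : ℝ => x ^ (r + 1)) (𝓝[<] 1) (𝓝 (1 ^ (r + 1))) :=
    ((continuous_pow (r + 1)).tendsto 1).mono_left nhdsWithin_le_nhds
  have h3 := h2.mul h1
  rw [one_pow, one_mul] at h3
  exact h3.congr fun x => (depthSeries_eq _ _ _).symm

/-- The series vanishes at 0 and is differentiable there, so it is O(x), which beats every power of
the logarithm. -/
theorem tendsto_depthSeries_mul_logPow (r s b : ℕ) :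
    Tendsto (fun x => depthSeries (r + 1) s x * logPow b x) (𝓝[>] 0) (𝓝 0) := by
  have h1 := hasDerivAt_iff_tendsto_slope.1 (hasDerivAt_depthSeries r s (x := 0) (by simp))
  have h2 := h1.mono_left (nhdsWithin_mono (0 : ℝ) (s := Set.Ioi 0) fun x hx => ne_of_gt hx)
  have h3 := h2.mul (tendsto_mul_logPow_zero b)
  rw [mul_zero] at h3
  refine h3.congr' ?_
  filter_upwards [self_mem_nhdsWithin] with x hx
  have : x ≠ 0 := ne_of_gt hx
  rw [slope_def_field, depthSeries_succ_zero]
  field_simp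
  ring

/-- `(2 (π / 4 - arctan x))^k / k!`. -/
noncomputable def coarctanPow (k : ℕ) (x : ℝ) : ℝ :=
  (2 * (Real.pi / 4 - Real.arctan x)) ^ k / k.factorial

theorem hasDerivAt_coarctanPow (k : ℕ) (x : ℝ) :
    HasDerivAt (coarctanPow k) (-(2 / (1 + x ^ 2) * delay (fun k => coarctanPow k x) k)) x := by
  unfold coarctanPow
  rcases k with _ | k
  · simp [delay, hasDerivAt_const]
  · refine (((((Real.hasDerivAt_arctan x).const_sub (Real.pi / 4)).const_mul 2).pow
      (k + 1)).div_const ((k + 1).factorial : ℝ)).congr_deriv ?_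
    rw [delay, Nat.factorial_succ]
    have : (k.factorial : ℝ) ≠ 0 := by positivity
    have : (1 + x ^ 2 : ℝ) ≠ 0 := by positivity
    simp only [Nat.add_sub_cancel]
    push_cast
    field_simp

theorem continuous_coarctanPow (k : ℕ) : Continuous (coarctanPow k) :=
  continuous_iff_continuousAt.2 fun x => (hasDerivAt_coarctanPow k x).continuousAt

theorem coarctanPow_one (k : ℕ) : coarctanPow k 1 = if k = 0 then 1 else 0 := by
  unfold coarctanPow
  rcases k with _ | k <;> simp [Real.arctan_one]

theorem hasDerivAt_logPow (s : ℕ) {t : ℝ} (ht : t ≠ 0) :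
    HasDerivAt (logPow s) (-(delay (fun s => logPow s t) s / t)) t := by
  rcases s with _ | s
  · have : logPow 0 = fun _ => 1 := funext logPow_zero
    rw [this]
    simp [delay, hasDerivAt_const]
  · exact hasDerivAt_logPow_succ s ht

theorem tendsto_logPow_one (s : ℕ) :
    Tendsto (logPow s) (𝓝[<] 1) (𝓝 (if s = 0 then 1 else 0)) := by
  rcases s with _ | s
  · rw [show logPow 0 = fun _ => 1 from funext logPow_zero]
    simp
  · simpa using tendsto_logPow_succ_one s

/-- The sum `W` as an integral. -/
theorem integral_coarctanPow_mul_logPow (r s : ℕ) :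
    ∫ x in (0 : ℝ)..1, 2 / (1 + x ^ 2) * coarctanPow r x * logPow s x =
      (-1) ^ (r + 1) * sumW (r + 1 + s) (r + 1) := by
  have hcont : ContinuousOn (fun x => 2 / (1 + x ^ 2) * coarctanPow r x) (Set.Icc 0 1) := by
    refine (Continuous.mul (continuous_const.div (by fun_prop) fun x => ?_)
      (continuous_coarctanPow r)).continuousOn
    positivity
  -- The antiderivative is the double convolution of the series with the powers of π/4 - arctan x
  -- and of -log x. At 0 every term tends to 0; at 1 only i = r, j = s survives.
  have h := intervalIntegral.integral_eq_sub_of_hasDerivAt_of_tendsto one_pos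
    (f := fun x => ∑ i ∈ Finset.range (r + 1), ∑ j ∈ Finset.range (s + 1),
      depthSeries (i + 1) j x * coarctanPow (r - i) x * logPow (s - j) x)
    (f' := fun x => 2 / (1 + x ^ 2) * coarctanPow r x * logPow s x)
    (fa := 0) (fb := (-1) ^ (r + 1) * sumW (r + 1 + s) (r + 1))
    ?_ (intervalIntegrable_mul_logPow s hcont) ?_ ?_
  · rw [h, sub_zero]
  · intro x hx
    have hx0 : x ≠ 0 := hx.1.ne'
    have hx1 : |x| < 1 := by rw [abs_of_pos hx.1]; exact hx.2
    have hd := HasDerivAt.fun_sum (u := Finset.range (r + 1)) fun i _ =>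
      HasDerivAt.fun_sum (u := Finset.range (s + 1)) fun j _ =>
        ((hasDerivAt_depthSeries_succ i j hx1 (Or.inl hx0)).fun_mul
          (hasDerivAt_coarctanPow (r - i) x)).fun_mul (hasDerivAt_logPow (s - j) hx0)
    refine hd.congr_deriv ?_
    set w := 2 / (1 + x ^ 2) with hw
    -- The terms with 1/x, from lowering s in the series and from the derivative of the logarithm,
    -- cancel after summing over j.
    have e1 : ∀ i, ∑ j ∈ Finset.range (s + 1),
        (((delay (fun s => depthSeries (i + 1) s x) j / x + w * depthSeries i j x) *
            coarctanPow (r - i) x +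
          depthSeries (i + 1) j x * -(w * delay (fun k => coarctanPow k x) (r - i))) *
            logPow (s - j) x +
          depthSeries (i + 1) j x * coarctanPow (r - i) x *
            -(delay (fun s => logPow s x) (s - j) / x)) =
        ∑ j ∈ Finset.range (s + 1), w * logPow (s - j) x *
          (depthSeries i j x * coarctanPow (r - i) x -
            depthSeries (i + 1) j x * delay (fun k => coarctanPow k x) (r - i)) := by
      intro i
      have h0 := sub_eq_zero.2 (sum_delay_mul (fun s => depthSeries (i + 1) s x)
        (fun s => logPow s x) s)
      rw [← Finset.sum_sub_distrib] at h0
      rw [← zero_add (∑ j ∈ _, w * _ * _), ← mul_zero (coarctanPow (r - i) x / x), ← h0,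
        Finset.mul_sum, ← Finset.sum_add_distrib]
      refine Finset.sum_congr rfl fun j _ => ?_
      ring
    simp only [e1]
    rw [Finset.sum_comm]
    -- The terms with 2/(1+x^2) telescope in i. What remains contains the series of depth 0, which
    -- is 1 for j = 0 and 0 otherwise.
    have e2 : ∀ j, ∑ i ∈ Finset.range (r + 1), w * logPow (s - j) x *
          (depthSeries i j x * coarctanPow (r - i) x -
            depthSeries (i + 1) j x * delay (fun k => coarctanPow k x) (r - i)) =
        w * logPow (s - j) x * (depthSeries 0 j x * coarctanPow r x) := by
      intro j
      rw [← Finset.mul_sum, Finset.sum_sub_distrib]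
      congr 1
      exact sum_mul_sub_sum_delay (fun i => depthSeries i j x) (fun k => coarctanPow k x) r
    simp only [e2]
    rw [Finset.sum_eq_single_of_mem 0 (by simp)]
    · simp [depthSeries_zero_left]
      ring
    · intro j _ hj
      simp [depthSeries_zero_left, hj]
  · have hl : Tendsto (fun x => ∑ i ∈ Finset.range (r + 1), ∑ j ∈ Finset.range (s + 1),
        depthSeries (i + 1) j x * coarctanPow (r - i) x * logPow (s - j) x) (𝓝[>] 0)
        (𝓝 (∑ i ∈ Finset.range (r + 1), ∑ j ∈ Finset.range (s + 1), coarctanPow (r - i) 0 * 0)) := by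
      refine tendsto_finsetSum _ fun i _ => tendsto_finsetSum _ fun j _ => ?_
      have h1 := ((continuous_coarctanPow (r - i)).tendsto 0).mono_left
        (nhdsWithin_le_nhds (s := Set.Ioi 0))
      refine (h1.mul (tendsto_depthSeries_mul_logPow i j (s - j))).congr fun x => ?_
      ring
    simpa using hl
  · have hl : Tendsto (fun x => ∑ i ∈ Finset.range (r + 1), ∑ j ∈ Finset.range (s + 1),
        depthSeries (i + 1) j x * coarctanPow (r - i) x * logPow (s - j) x) (𝓝[<] 1)
        (𝓝 (∑ i ∈ Finset.range (r + 1), ∑ j ∈ Finset.range (s + 1),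
          (-1) ^ (i + 1) * sumW (i + 1 + j) (i + 1) * coarctanPow (r - i) 1 *
            (if s - j = 0 then 1 else 0))) := by
      refine tendsto_finsetSum _ fun i _ => tendsto_finsetSum _ fun j _ => ?_
      exact ((tendsto_depthSeries_one i j).mul (((continuous_coarctanPow (r - i)).tendsto
        1).mono_left nhdsWithin_le_nhds)).mul (tendsto_logPow_one (s - j))
    convert hl using 2
    rw [Finset.sum_eq_single_of_mem r (by simp), Finset.sum_eq_single_of_mem s (by simp)]
    · simp [coarctanPow_one]
    · intro j hj hjs
      rw [Finset.mem_range] at hj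
      rw [if_neg (by omega), mul_zero]
    · intro i hi hir
      rw [Finset.mem_range] at hi
      refine Finset.sum_eq_zero fun j _ => ?_
      rw [coarctanPow_one, if_neg (by omega), mul_zero, zero_mul]

/-! ### The alternating series of products -/

theorem two_div_one_add_sq_le {t : ℝ} (ht : 0 < t) : 2 / (1 + t) ^ 2 ≤ 2 := by
  rw [div_le_iff₀ (by positivity)]
  nlinarith

theorem continuousOn_two_div_one_add_sq :
    ContinuousOn (fun t : ℝ => 2 / (1 + t) ^ 2) (Set.Icc 0 1) :=
  continuousOn_const.div (by fun_prop) fun t ht => by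
    have := ht.1
    positivity

theorem cayleyMoment_div (s n : ℕ) :
    cayleyMoment s (n + 1) / ((n : ℝ) + 1) =
      ∫ t in (0 : ℝ)..1, cayley t ^ n * (2 / (1 + t) ^ 2) * logPow s t := by
  have hn : (n : ℝ) + 1 ≠ 0 := by positivity
  rw [div_eq_iff hn, mul_comm, cayleyMoment, ← intervalIntegral.integral_const_mul]
  refine intervalIntegral.integral_congr fun t _ => ?_
  simp only [Nat.add_sub_cancel]
  push_cast
  ring

/-- For z < 1 the geometric factor z^{2i} dominates the linearly bounded partial sums, and the
kernel is at most 2, so sum and integral may be interchanged. -/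
theorem hasSum_cayleyMoment (r s : ℕ) {z : ℝ} (h0 : 0 < z) (h1 : z < 1) :
    HasSum (fun i : ℕ => (-1) ^ i * depthSum r 0 i *
        (cayleyMoment s (r + 2 * i + 1) / (((r + 2 * i : ℕ) : ℝ) + 1)) * (z ^ 2) ^ i)
      (∫ t in (0 : ℝ)..1, 2 / (1 + t) ^ 2 * cayley t ^ r *
        (∑' i, (-1) ^ i * depthSum r 0 i * ((z * cayley t) ^ 2) ^ i) * logPow s t) := by
  have hz : |z ^ 2| < 1 := abs_sq_lt_one (by rwa [abs_of_pos h0])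
  obtain ⟨C, hC⟩ := (logGrowth_depthSum r 0).exists_bound
  have hS := summable_mul_pow_of_linear_bound hC hz
  have hF : ∀ i : ℕ, (-1) ^ i * depthSum r 0 i *
        (cayleyMoment s (r + 2 * i + 1) / (((r + 2 * i : ℕ) : ℝ) + 1)) * (z ^ 2) ^ i =
      ∫ t in (0 : ℝ)..1, (-1) ^ i * depthSum r 0 i * (z ^ 2) ^ i *
        (cayley t ^ (r + 2 * i) * (2 / (1 + t) ^ 2) * logPow s t) := by
    intro i
    rw [cayleyMoment_div, intervalIntegral.integral_const_mul]
    ring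
  simp only [hF]
  refine intervalIntegral.hasSum_integral_of_dominated_convergence
    (fun i t => |depthSum r 0 i| * |z ^ 2| ^ i * (2 * logPow s t)) (fun i => ?_) (fun i => ?_)
    ?_ ?_ ?_
  · refine (IntervalIntegrable.const_mul (intervalIntegrable_mul_logPow s ?_)
      _).def'.aestronglyMeasurable
    exact (continuousOn_cayley.pow _).mul continuousOn_two_div_one_add_sq
  · refine Eventually.of_forall fun t ht => ?_
    rw [Set.uIoc_of_le zero_le_one] at ht
    have hL := logPow_nonneg (s := s) ht.1.le ht.2
    have hc := cayley_nonneg ht.1.le ht.2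
    rw [Real.norm_eq_abs, abs_mul, abs_mul, abs_neg_one_pow_mul, abs_pow]
    refine mul_le_mul_of_nonneg_left ?_ (by positivity)
    have h2 : 0 ≤ 2 / (1 + t) ^ 2 := by positivity
    rw [abs_of_nonneg (by positivity)]
    refine mul_le_mul_of_nonneg_right ?_ hL
    calc cayley t ^ (r + 2 * i) * (2 / (1 + t) ^ 2) ≤ 1 * 2 :=
          mul_le_mul (pow_le_one₀ hc (cayley_lt_one ht.1).le) (two_div_one_add_sq_le ht.1) h2
            zero_le_one
      _ = 2 := one_mul 2
  · exact Eventually.of_forall fun t _ => hS.mul_right _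
  · simp only [tsum_mul_right]
    exact ((intervalIntegrable_logPow s).const_mul 2).const_mul _
  · refine Eventually.of_forall fun t ht => ?_
    rw [Set.uIoc_of_le zero_le_one] at ht
    have hc := cayley_nonneg ht.1.le ht.2
    have hlt : |(z * cayley t) ^ 2| < 1 := by
      refine abs_sq_lt_one ?_
      rw [abs_of_nonneg (by positivity)]
      nlinarith [cayley_lt_one ht.1]
    have h2 := ((summable_depthSum r 0 hlt).hasSum.mul_left
      (2 / (1 + t) ^ 2 * cayley t ^ r)).mul_right (logPow s t)
    refine Eq.mp (congrArg (fun f => HasSum f _) (funext fun i => ?_)) h2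
    rw [mul_pow, mul_pow, pow_add, pow_mul (cayley t)]
    ring

theorem pow_mul_tsum_cayleyMoment (r s : ℕ) {z : ℝ} (h0 : 0 < z) (h1 : z < 1) :
    z ^ r * ∑' i : ℕ, (-1) ^ i * depthSum r 0 i *
        (cayleyMoment s (r + 2 * i + 1) / (((r + 2 * i : ℕ) : ℝ) + 1)) * (z ^ 2) ^ i =
      ∫ t in (0 : ℝ)..1, 2 / (1 + t) ^ 2 * ((2 * Real.arctan (z * cayley t)) ^ r / r.factorial /
        (1 + (z * cayley t) ^ 2)) * logPow s t := by
  rw [(hasSum_cayleyMoment r s h0 h1).tsum_eq, ← intervalIntegral.integral_const_mul,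
    intervalIntegral.integral_of_le zero_le_one, intervalIntegral.integral_of_le zero_le_one]
  refine MeasureTheory.setIntegral_congr_fun measurableSet_Ioc fun t ht => ?_
  have hc := cayley_nonneg ht.1.le ht.2
  have hc0 : 0 ≤ z * cayley t := by positivity
  have hc1 : z * cayley t < 1 := by nlinarith [cayley_lt_one ht.1]
  have h2 := pow_mul_tsum_depthSum r 0 (x := z * cayley t) (by rwa [abs_of_nonneg hc0])
  rw [← depthSeries_zero_right r hc0 hc1, ← h2, mul_pow]
  ring

theorem arctan_cayley {t : ℝ} (h0 : 0 < t) (h1 : t ≤ 1) :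
    Real.arctan (cayley t) = Real.pi / 4 - Real.arctan t := by
  have h : t * cayley t < 1 := by
    have := cayley_lt_one h0
    have := cayley_nonneg h0.le h1
    nlinarith
  have h2 := Real.arctan_add h
  have h3 : (t + cayley t) / (1 - t * cayley t) = 1 := by
    rw [div_eq_one_iff_eq (by linarith)]
    unfold cayley
    have : 1 + t ≠ 0 := by linarith
    field_simp
    ring
  rw [h3, Real.arctan_one] at h2
  linarith

/-- Dominated convergence as z → 1 in the closed form of the integral; arctan is bounded, so (-log
t)^s / s! times a constant dominates. -/
theorem tendsto_pow_mul_tsum_cayleyMoment (r s : ℕ) :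
    Tendsto (fun z : ℝ => z ^ r * ∑' i : ℕ, (-1) ^ i * depthSum r 0 i *
        (cayleyMoment s (r + 2 * i + 1) / (((r + 2 * i : ℕ) : ℝ) + 1)) * (z ^ 2) ^ i)
      (𝓝[<] 1) (𝓝 ((-1) ^ (r + 1) * sumW (r + 1 + s) (r + 1) / 2)) := by
  have hmem : Set.Ioo (0 : ℝ) 1 ∈ 𝓝[<] (1 : ℝ) := Ioo_mem_nhdsLT one_pos
  have h : Tendsto (fun z : ℝ => ∫ t in (0 : ℝ)..1, 2 / (1 + t) ^ 2 *
        ((2 * Real.arctan (z * cayley t)) ^ r / r.factorial / (1 + (z * cayley t) ^ 2)) * logPow s t)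
      (𝓝[<] 1) (𝓝 (∫ t in (0 : ℝ)..1, (2 / (1 + t ^ 2) * coarctanPow r t * logPow s t) / 2)) := by
    refine intervalIntegral.tendsto_integral_filter_of_dominated_convergence
      (fun t => 2 * Real.pi ^ r * logPow s t) (Eventually.of_forall fun z => ?_)
      (Eventually.of_forall fun z => Eventually.of_forall fun t ht => ?_)
      ((intervalIntegrable_logPow s).const_mul _) (Eventually.of_forall fun t ht => ?_)
    · refine (intervalIntegrable_mul_logPow s
        (continuousOn_two_div_one_add_sq.mul ?_)).def'.aestronglyMeasurable
      have hc : ContinuousOn (fun t => z * cayley t) (Set.Icc 0 1) :=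
        continuousOn_const.mul continuousOn_cayley
      have hg : Continuous fun x : ℝ => (2 * Real.arctan x) ^ r / r.factorial / (1 + x ^ 2) := by
        refine Continuous.div (by fun_prop) (by fun_prop) fun x => ?_
        positivity
      exact hg.comp_continuousOn hc
    · rw [Set.uIoc_of_le zero_le_one] at ht
      rw [norm_mul, Real.norm_of_nonneg (logPow_nonneg ht.1.le ht.2), norm_mul]
      refine mul_le_mul_of_nonneg_right ?_ (logPow_nonneg ht.1.le ht.2)
      refine mul_le_mul ?_ ?_ (norm_nonneg _) zero_le_two
      · have : 0 ≤ 2 / (1 + t) ^ 2 := by positivity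
        rw [Real.norm_of_nonneg this]
        exact two_div_one_add_sq_le ht.1
      · have h1 : |2 * Real.arctan (z * cayley t)| ≤ Real.pi := by
          rw [abs_le]
          constructor <;> linarith [Real.neg_pi_div_two_lt_arctan (z * cayley t),
            Real.arctan_lt_pi_div_two (z * cayley t)]
        rw [norm_div, norm_div, norm_pow, Real.norm_eq_abs (2 * _)]
        refine (div_le_self (by positivity) ?_).trans ((div_le_self (by positivity) ?_).trans ?_)
        · rw [Real.norm_of_nonneg (by positivity)]
          nlinarith [sq_nonneg (z * cayley t)]
        · rw [Real.norm_of_nonneg (by positivity)]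
          exact_mod_cast r.factorial_pos
        · gcongr
    · rw [Set.uIoc_of_le zero_le_one] at ht
      have hg : Continuous fun z : ℝ => 2 / (1 + t) ^ 2 *
          ((2 * Real.arctan (z * cayley t)) ^ r / r.factorial / (1 + (z * cayley t) ^ 2)) *
            logPow s t := by
        refine (continuous_const.mul (Continuous.div (by fun_prop) (by fun_prop) fun x => ?_)).mul
          continuous_const
        positivity
      have h2 := (hg.tendsto 1).mono_left (nhdsWithin_le_nhds (s := Set.Iio 1))
      convert h2 using 2
      rw [one_mul, arctan_cayley ht.1 ht.2, coarctanPow]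
      have h3 : 1 + t ≠ 0 := by linarith [ht.1]
      have h4 : 1 + t ^ 2 ≠ 0 := by positivity
      -- Consequently 2/(1+t)^2 divided by 1 + c^2, with c = (1-t)/(1+t), is 1/(1+t^2): half the
      -- kernel of the integral for W, whence the factor 1/2 in the limit.
      have h5 : 1 + cayley t ^ 2 = 2 * (1 + t ^ 2) / (1 + t) ^ 2 := by
        unfold cayley
        field_simp
        ring
      rw [h5]
      field_simp
  rw [intervalIntegral.integral_div, integral_coarctanPow_mul_logPow] at h
  refine h.congr' ?_
  filter_upwards [hmem] with z hz
  rw [pow_mul_tsum_cayleyMoment r s hz.1 hz.2]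

/-! ### Proof of the theorem -/

theorem theorem3p2 (m p : ℕ) (hm : 1 ≤ m) (hp : 1 ≤ p) :
    -- every alternating multiple `T`-value on the right-hand side is a convergent series
    (∀ j ∈ Finset.Icc 1 p, ∀ k ∈ indexSet (2 * j + 2 * m - 1) (2 * m),
      Tendsto (altMTVPartialSum k) atTop (𝓝 (altMTV k))) ∧
    -- the alternating series on the left-hand side converges to the right-hand side
    Tendsto
      (fun N : ℕ => ∑ n ∈ Finset.Icc 1 N,
        multipleTHarmonicSum n (fun _ : Fin (2 * m - 1) => 1) *
          multipleTHarmonicSum n (fun _ : Fin (2 * p - 1) => 1) / (n : ℝ) * (-1 : ℝ) ^ n)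
      atTop
      (𝓝 ((-1 : ℝ) ^ m *
        ∑ j ∈ Finset.Icc 1 p, sumW (2 * j + 2 * m - 1) (2 * m) * coeffZ j p)) := by
  obtain ⟨M, rfl⟩ : ∃ M, m = M + 1 := ⟨m - 1, by omega⟩
  obtain ⟨P, rfl⟩ : ∃ P, p = P + 1 := ⟨p - 1, by omega⟩
  refine ⟨fun j _ k hk => tendsto_altMTVPartialSum (r := 2 * M + 1)
    (one_le_of_mem_indexSet hk), ?_⟩
  -- Terms with n ≤ M vanish, so n = M + 1 + i, and 1/n is written as 2/(2n) to match the moments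
  -- M_s(2n)/(2n). The exponent 1 fits `LogGrowth.div_pow`.
  set g : ℕ → ℝ := fun i => 2 * (onesTSum (2 * M + 1) (M + 1 + i) *
    onesTSum (2 * P + 1) (M + 1 + i)) / ((2 * M + 2 : ℝ) + 2 * i) ^ 1 with hg
  have hdecay : LogDecay g :=
    ((LogGrowth.const 2).mul (((logGrowth_onesTSum (2 * M + 1)).shift_add (M + 1)).mul
      ((logGrowth_onesTSum (2 * P + 1)).shift_add (M + 1)))).div_pow
      (by linarith [M.cast_nonneg (α := ℝ)]) le_rfl
  obtain ⟨l, hl⟩ := hdecay.exists_tendsto_alternating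
  have hgsum : ∀ i, g i = 2 * ∑ j ∈ Finset.range (P + 1), coeffZ (j + 1) (P + 1) *
      (depthSum (2 * M + 1) 0 i * (cayleyMoment (2 * j + 1) (2 * M + 1 + 2 * i + 1) /
        (((2 * M + 1 + 2 * i : ℕ) : ℝ) + 1))) := by
    intro i
    simp only [hg]
    rw [(onesTSum_eq_depthSum M).1.2, onesTSum_eq_sum_cayleyMoment,
      show 2 * (M + 1 + i) = 2 * M + 1 + 2 * i + 1 by ring, pow_one, Finset.mul_sum,
      Finset.mul_sum, Finset.sum_div, Finset.mul_sum]
    refine Finset.sum_congr rfl fun j _ => ?_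
    push_cast
    rw [show (2 : ℝ) * M + 1 + 2 * i + 1 = 2 * M + 2 + 2 * i by ring]
    ring
  -- The series is already known to converge to l, so Abel's theorem identifies l with the limit of
  -- its power series as z → 1; this is compared with the limits computed for each moment.
  have hvalue : l = ∑ j ∈ Finset.range (P + 1),
      sumW (2 * (j + 1) + 2 * (M + 1) - 1) (2 * (M + 1)) * coeffZ (j + 1) (P + 1) := by
    have h0 : Tendsto (fun z : ℝ => z ^ (2 * M + 1)) (𝓝[<] 1) (𝓝 (1 ^ (2 * M + 1))) :=
      ((continuous_pow _).tendsto 1).mono_left nhdsWithin_le_nhds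
    have h1 := h0.mul ((Real.tendsto_tsum_powerSeries_nhdsWithin_lt hl).comp tendsto_sq_nhdsLT_one)
    rw [one_pow, one_mul] at h1
    have h2 : Tendsto (fun z : ℝ => 2 * ∑ j ∈ Finset.range (P + 1), coeffZ (j + 1) (P + 1) *
        (z ^ (2 * M + 1) * ∑' i : ℕ, (-1) ^ i * depthSum (2 * M + 1) 0 i *
          (cayleyMoment (2 * j + 1) (2 * M + 1 + 2 * i + 1) /
            (((2 * M + 1 + 2 * i : ℕ) : ℝ) + 1)) * (z ^ 2) ^ i)) (𝓝[<] 1)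
        (𝓝 (2 * ∑ j ∈ Finset.range (P + 1), coeffZ (j + 1) (P + 1) *
          ((-1) ^ (2 * M + 1 + 1) * sumW (2 * M + 1 + 1 + (2 * j + 1)) (2 * M + 1 + 1) / 2))) :=
      (tendsto_finsetSum _ fun j _ =>
        (tendsto_pow_mul_tsum_cayleyMoment (2 * M + 1) (2 * j + 1)).const_mul _).const_mul 2
    have h3 := tendsto_nhds_unique (h1.congr' ?_) h2
    · rw [h3, Finset.mul_sum]
      refine Finset.sum_congr rfl fun j _ => ?_
      rw [show 2 * (j + 1) + 2 * (M + 1) - 1 = 2 * M + 1 + 1 + (2 * j + 1) by omega,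
        show 2 * (M + 1) = 2 * M + 1 + 1 by ring, Even.neg_one_pow (by use M + 1; ring)]
      ring
    · filter_upwards [Ioo_mem_nhdsLT (zero_lt_one (α := ℝ))] with z hz
      have hs := hasSum_sum (s := Finset.range (P + 1)) fun j _ =>
        (hasSum_cayleyMoment (2 * M + 1) (2 * j + 1) hz.1 hz.2).mul_left (coeffZ (j + 1) (P + 1))
      have hs2 := (hs.mul_left 2).tsum_eq
      simp only [Function.comp_apply]
      simp only [(hasSum_cayleyMoment (2 * M + 1) _ hz.1 hz.2).tsum_eq]
      rw [show (∑' i, (-1) ^ i * g i * (z ^ 2) ^ i) = _ from (tsum_congr fun i => ?_).trans hs2]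
      · simp only [Finset.mul_sum]
        refine Finset.sum_congr rfl fun j _ => ?_
        ring
      · rw [hgsum, Finset.mul_sum, Finset.mul_sum, Finset.mul_sum, Finset.sum_mul]
        refine Finset.sum_congr rfl fun j _ => ?_
        ring
  have hIcc : ∑ j ∈ Finset.Icc 1 (P + 1), sumW (2 * j + 2 * (M + 1) - 1) (2 * (M + 1)) *
      coeffZ j (P + 1) = l := by
    rw [hvalue, sum_Icc_one_eq_sum_range]
  rw [hIcc, ← tendsto_add_atTop_iff_nat (M + 1)]
  -- The shift n = M + 1 + i splits (-1)^n into (-1)^{M+1} (-1)^i, which is the sign (-1)^m of the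
  -- statement.
  refine (((tendsto_add_atTop_iff_nat 1).2 hl).const_mul ((-1) ^ (M + 1))).congr fun i => ?_
  change _ = ∑ n ∈ Finset.Icc 1 (i + (M + 1)), onesTSum (2 * M + 1) n * onesTSum (2 * P + 1) n /
    (n : ℝ) * (-1 : ℝ) ^ n
  rw [add_comm i (M + 1), sum_Icc_one_add_eq_sum_range (m := M + 1) (by omega), Finset.mul_sum]
  · refine Finset.sum_congr rfl fun j _ => ?_
    simp only [hg]
    have : (M : ℝ) + 1 + j ≠ 0 := by positivity
    rw [pow_one, show (2 * M + 2 : ℝ) + 2 * j = 2 * (M + 1 + j) by ring, pow_add _ (M + 1) j]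
    push_cast
    field_simp
  · intro n _ hn
    rw [(onesTSum_eq_depthSum M).1.1 n (by omega), zero_mul, zero_div, zero_mul]
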